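/- Let $c>0$ and $\xi\in(-c^2/2,\,c^2/3)$. Then there is a unique $a=a(\xi)\in(0,c)$ with $$\int_{a}^{0}\Big(\xi+\frac{c^2-a^2}{2}-s^2\Big)\sqrt{\frac{s^2-a^2}{c^2-s^2}}\,ds=0$$ (principal square root). Let $\mathcal R(\lambda)=\sqrt{\lambda(\lambda+c^2)(\lambda+a^2)}$ on the elliptic Riemann surface $\mathbb M(\xi)$ of $y^2=\lambda(\lambda+c^2)(\lambda+a^2)$, cut along $[-c^2,-a^2]\cup[0,\infty)$, with $\mathcal R>0$ on the upper side of $[0,\infty)$ on the upper sheet. The cycle $\mathfrak b$ surrounds $[-c^2,-a^2]$ clockwise on the upper sheet; the cycle $\mathfrak a$ runs from $-a^2$ to $0$ on the lower sheet and back from $0$ to $-a^2$ on the upper sheet. Put $$h(\xi)=\int_{\mathfrak a}\frac{\lambda\,d\lambda}{\mathcal R(\lambda)}\Big(\int_{\mathfrak a}\frac{d\lambda}{\mathcal R(\lambda)}\Big)^{-1},\qquad d\Omega_1=\frac{\mathrm i}{2}\frac{\lambda-h}{\mathcal R(\lambda)}\,d\lambda,\qquad d\Omega_3=-\frac{3\mathrm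 i}{2}\frac{(\lambda-\nu_1)(\lambda-\nu_2)}{\mathcal R(\lambda)}\,d\lambda,$$ where $\nu_1,\nu_2\in\mathbb R$ are such that $\int_{\mathfrak a}d\Omega_3=0$ and $2\nu_1+2\nu_2+c^2+a^2=0$ (such $\nu_1,\nu_2$ exist), and define $V(\xi),W(\xi)$ by $\mathrm iV=\int_{\mathfrak b}d\Omega_1$, $\mathrm iW=\int_{\mathfrak b}d\Omega_3$. Further let $$B(\xi)=24\int_{a(\xi)}^{c}\Big(\xi+\frac{c^2-a^2(\xi)}{2}-s^2\Big)\sqrt{\frac{s^2-a^2(\xi)}{c^2-s^2}}\,ds,\qquad \Gamma(\xi)=-\frac12\Big(\int_{-a(\xi)}^{a(\xi)}\frac{ds}{\sqrt{(c^2-s^2)(a^2(\xi)-s^2)}}\Big)^{-1},$$ $$z(\xi)=\tfrac12\big(12\xi(c^2-a(\xi)^2)+3c^4+9a(\xi)^4-6a(\xi)^2c^2\big).$$ Then $V(\xi)$, $W(\xi)$, $h(\xi)$ are real, $B$ and $z$ are differentiable at $\xi$, and: 1. $tB(\xi)=-4W(\xi)t+V(\xi)x$ for all real $x$ and $t\neq0$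 with $\xi=\frac{x}{12t}$; 2. $B'(\xi)=12V(\xi)$ and $4\pi\Gamma(\xi)=-V(\xi)$; 3. $\frac16z'(\xi)=c^2+a^2(\xi)+2h(\xi)$. -/

import Mathlib

noncomputable section

namespace OneGap

/-- `α` is the band edge at `ξ`: `0 < α < c` and
`∫_α^0 (ξ + (c² - α²)/2 - s²) √((s² - α²)/(c² - s²)) ds = 0`.
The radicand is negative for `0 ≤ s < α`, so the square root is the principal complex one. -/
def IsBandEdge (c ξ α : ℝ) : Prop :=
  0 < α ∧ α < c ∧
    ∫ s in α..0, ((ξ + (c ^ 2 - α ^ 2) / 2 - s ^ 2 : ℝ) : ℂ) *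
      (((s ^ 2 - α ^ 2) / (c ^ 2 - s ^ 2) : ℝ) : ℂ) ^ (1 / 2 : ℂ) = 0

/-- The function `a(ξ)`. -/
def a (c ξ : ℝ) : ℝ := Classical.epsilon (IsBandEdge c ξ)

/-- The upper-sheet branch of `√(λ(λ + c²)(λ + α²))` with cuts `[-c², -α²]` and `[0, ∞)`,
positive on the upper side of `[0, ∞)`. The powers are principal: `i (-λ)^{1/2}` is the square
root of `λ` with cut `[0, ∞)` that is positive on the upper side of the cut, and the product of the
other two factors is analytic off `[-c², -α²]`. The value on the lower sheet is the negative. -/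
def R (c α : ℝ) (l : ℂ) : ℂ :=
  Complex.I * (-l) ^ (1 / 2 : ℂ) * (l + (c : ℂ) ^ 2) ^ (1 / 2 : ℂ) * (l + (α : ℂ) ^ 2) ^ (1 / 2 : ℂ)

/-- The integral over the cycle `𝔞` of the differential `φ(λ, y) dλ` on the surface
`y² = λ(λ + c²)(λ + α²)`: from `-α²` to `0` on the lower sheet, where `y = -R(λ)`, and back from
`0` to `-α²` on the upper sheet, where `y = R(λ)`. -/
def aPeriod (c α : ℝ) (φ : ℂ → ℂ → ℂ) : ℂ :=
  (∫ l in (-α ^ 2)..0, φ (l : ℂ) (-R c α (l : ℂ))) +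
    ∫ l in (0 : ℝ)..(-α ^ 2), φ (l : ℂ) (R c α (l : ℂ))

/-- The integral over the cycle `𝔟` of the differential `φ(λ, y) dλ`. The cycle surrounds
`[-c², -α²]` clockwise on the upper sheet; it is the circle with centre `-(c² + α²)/2` and radius
`c²/2`, which crosses the real axis at `-c² - α²/2` and in the gap at `-α²/2`. -/
def bPeriod (c α : ℝ) (φ : ℂ → ℂ → ℂ) : ℂ :=
  -∮ l in C(-((c : ℂ) ^ 2 + (α : ℂ) ^ 2) / 2, c ^ 2 / 2), φ l (R c α l)

/-- `h = ∫_𝔞 λ dλ/R (∫_𝔞 dλ/R)⁻¹` for the surface with branch points `-c², -α², 0, ∞`. -/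
def hOf (c α : ℝ) : ℂ :=
  aPeriod c α (fun l y => l / y) * (aPeriod c α (fun _ y => 1 / y))⁻¹

/-- The coefficient of `dΩ₁ = (i/2) (λ - h)/R dλ`. -/
def dOmega1 (c α : ℝ) (l y : ℂ) : ℂ :=
  Complex.I / 2 * ((l - hOf c α) / y)

/-- The coefficient of `-(3i/2) (λ - ν₁)(λ - ν₂)/R dλ`. -/
def dOmega3Form (ν : ℝ × ℝ) (l y : ℂ) : ℂ :=
  -(3 * Complex.I / 2) * ((l - (ν.1 : ℂ)) * (l - (ν.2 : ℂ)) / y)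

/-- The two conditions that fix the pair of zeros `ν₁, ν₂` of `dΩ₃` up to order. -/
def IsZeroPair (c α : ℝ) (ν : ℝ × ℝ) : Prop :=
  2 * ν.1 + 2 * ν.2 + c ^ 2 + α ^ 2 = 0 ∧ aPeriod c α (dOmega3Form ν) = 0

/-- The zeros `ν₁, ν₂` of `dΩ₃`. -/
def nu (c α : ℝ) : ℝ × ℝ := Classical.epsilon (IsZeroPair c α)

/-- The coefficient of `dΩ₃`. -/
def dOmega3 (c α : ℝ) (l y : ℂ) : ℂ := dOmega3Form (nu c α) l y

/-- `h(ξ)`. -/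
def h (c ξ : ℝ) : ℂ := hOf c (a c ξ)

/-- The wave number: `i V = ∫_𝔟 dΩ₁`. -/
def V (c ξ : ℝ) : ℂ := bPeriod c (a c ξ) (dOmega1 c (a c ξ)) / Complex.I

/-- The frequency: `i W = ∫_𝔟 dΩ₃`. -/
def W (c ξ : ℝ) : ℂ := bPeriod c (a c ξ) (dOmega3 c (a c ξ)) / Complex.I

/-- `B(ξ) = 24 ∫_a^c (ξ + (c² - a²)/2 - s²) √((s² - a²)/(c² - s²)) ds`. -/
def B (c ξ : ℝ) : ℝ :=
  24 * ∫ s in (a c ξ)..c, (ξ + (c ^ 2 - a c ξ ^ 2) / 2 - s ^ 2) *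
    √((s ^ 2 - a c ξ ^ 2) / (c ^ 2 - s ^ 2))

/-- `Γ(ξ) = -(1/2) (∫_{-a}^a ((c² - s²)(a² - s²))^{-1/2} ds)⁻¹`. -/
def Gam (c ξ : ℝ) : ℝ :=
  -(1 / 2) * (∫ s in (-a c ξ)..(a c ξ), (√((c ^ 2 - s ^ 2) * (a c ξ ^ 2 - s ^ 2)))⁻¹)⁻¹

/-- `z(ξ)`. -/
def z (c ξ : ℝ) : ℝ :=
  (12 * ξ * (c ^ 2 - a c ξ ^ 2) + 3 * c ^ 4 + 9 * a c ξ ^ 4 - 6 * a c ξ ^ 2 * c ^ 2) / 2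

end OneGap

end

noncomputable section

namespace OneGap

open Real Set Filter Topology MeasureTheory intervalIntegral

/-! Everything reduces to complete elliptic integrals with C = c² and q = a². Write K, E for `ellK`,
`ellE` at q and K', E' for their values at C - q; `ellM` reduces to these by `three_mul_ellM`. The
gap [-a², 0] carries the parameter q and the band [-c², -a²] the complementary one: 𝔞-periods are
combinations of K and E, and 𝔟-periods, once the circle is collapsed onto the cut, of K' and E'.

Hence h = E/K - c² and V = 2(E' + hK'), and Legendre's relation becomes V = π/K. The integral in Γ
is 2K, so 4πΓ = -V. The normalisation of dΩ₃ expresses ν₁ν₂ through h, which gives W = (c² + a²)V/2.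
The band-edge equation `bandFun` = 0, divided by K, is an algebraic relation between ξ, a² and h
(`hReal_relation`); it turns B into (12ξ - 2(c² + a²))V, and identity 1 follows with x = 12tξ.

The q-derivative of `bandFun` is wK/2 with w = ξ + C/2 - 3q/2. So `bandFun` rises from 0 and then
falls to a negative limit: there is one zero, and w < 0 there. Implicit differentiation gives
w·(a²)' = -2(h + a²). As ∂B/∂q = -12wK' and ∂z/∂q = -6w, the factor w cancels and the formulas for
B' and z' remain. -/

/-- Differentiation under the integral sign for a jointly continuous derivative. -/
theorem hasDerivAt_intervalIntegral_of_continuousOn {F F' : ℝ → ℝ → ℝ} {a b x₀ : ℝ} {U : Set ℝ}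
    (hU : U ∈ 𝓝 x₀) (hF : ∀ x ∈ U, ContinuousOn (F x) (uIcc a b))
    (hF' : ContinuousOn (Function.uncurry F') (U ×ˢ uIcc a b))
    (hd : ∀ x ∈ U, ∀ t ∈ uIcc a b, HasDerivAt (fun y => F y t) (F' x t) x) :
    HasDerivAt (fun x => ∫ t in a..b, F x t) (∫ t in a..b, F' x₀ t) x₀ := by
  obtain ⟨ε, hε, hball⟩ := Metric.nhds_basis_closedBall.mem_iff.1 hU
  have hx₀ : x₀ ∈ U := mem_of_mem_nhds hU
  have hcomp : IsCompact (Metric.closedBall x₀ ε ×ˢ uIcc a b) :=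
    (isCompact_closedBall x₀ ε).prod isCompact_uIcc
  obtain ⟨M, hM⟩ := hcomp.exists_bound_of_continuousOn (hF'.mono (prod_mono_left hball))
  have hF'₀ : ContinuousOn (F' x₀) (uIcc a b) :=
    hF'.comp (f := fun t => (x₀, t)) (by fun_prop) fun t ht => ⟨hx₀, ht⟩
  refine (hasDerivAt_integral_of_dominated_loc_of_deriv_le (F := F) (F' := F') (bound := fun _ => M)
    (Metric.closedBall_mem_nhds x₀ hε) ?_ (hF x₀ hx₀).intervalIntegrable ?_ ?_
    intervalIntegrable_const ?_).2
  · filter_upwards [hU] with x hx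
    exact ((hF x hx).mono uIoc_subset_uIcc).aestronglyMeasurable measurableSet_uIoc
  · exact (hF'₀.mono uIoc_subset_uIcc).aestronglyMeasurable measurableSet_uIoc
  · exact ae_of_all _ fun t ht x hx => hM (x, t) ⟨hx, uIoc_subset_uIcc ht⟩
  · exact ae_of_all _ fun t ht x hx => hd x (hball hx) t (uIoc_subset_uIcc ht)

/-! ### Complete elliptic integrals: derivatives, reduction formulas, Legendre's relation. -/

/-- The complete elliptic integral of the first kind `∫_0^{π/2} (C - q sin² φ)^{-1/2} dφ`. -/
def ellK (C q : ℝ) : ℝ := ∫ φ in (0 : ℝ)..π / 2, (√(C - q * sin φ ^ 2))⁻¹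

/-- The complete elliptic integral of the second kind `∫_0^{π/2} (C - q sin² φ)^{1/2} dφ`. -/
def ellE (C q : ℝ) : ℝ := ∫ φ in (0 : ℝ)..π / 2, √(C - q * sin φ ^ 2)

/-- The integral `∫_0^{π/2} (C - q sin² φ)^{3/2} dφ`. -/
def ellM (C q : ℝ) : ℝ := ∫ φ in (0 : ℝ)..π / 2, √(C - q * sin φ ^ 2) ^ 3

/-- The radicand is C cos² φ + (C - q) sin² φ. No sign of q is assumed, so that the admissible q
form a neighbourhood of 0, where limits are taken later. -/
theorem radicand_pos {C q : ℝ} (hC : 0 < C) (hq : q < C) (φ : ℝ) : 0 < C - q * sin φ ^ 2 := by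
  have h := sin_sq_add_cos_sq φ
  have h1 : C - q * sin φ ^ 2 = C * cos φ ^ 2 + (C - q) * sin φ ^ 2 := by
    linear_combination C * (-h)
  rw [h1]
  rcases eq_or_ne (cos φ) 0 with h0 | h0
  · have : sin φ ^ 2 = 1 := by rw [h0] at h; linarith
    rw [this, h0]; linarith
  · have := mul_nonneg (sub_pos.2 hq).le (sq_nonneg (sin φ))
    have : 0 < C * cos φ ^ 2 := by positivity
    linarith

theorem radicand_ne_zero {C q : ℝ} (hC : 0 < C) (hq : q < C) (φ : ℝ) :
    C - q * sin φ ^ 2 ≠ 0 := (radicand_pos hC hq φ).ne'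

theorem sqrt_radicand_ne_zero {C q : ℝ} (hC : 0 < C) (hq : q < C) (φ : ℝ) :
    √(C - q * sin φ ^ 2) ≠ 0 := (sqrt_pos.2 (radicand_pos hC hq φ)).ne'

theorem continuous_ellE_integrand (C q : ℝ) : Continuous fun φ => √(C - q * sin φ ^ 2) := by
  fun_prop

theorem continuous_ellK_integrand {C q : ℝ} (hC : 0 < C) (hq : q < C) :
    Continuous fun φ => (√(C - q * sin φ ^ 2))⁻¹ :=
  (continuous_ellE_integrand C q).inv₀ (sqrt_radicand_ne_zero hC hq)

theorem continuous_ellK_integrand_cube {C q : ℝ} (hC : 0 < C) (hq : q < C) :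
    Continuous fun φ => (√(C - q * sin φ ^ 2))⁻¹ ^ 3 :=
  (continuous_ellK_integrand hC hq).pow 3

theorem continuous_ellM_integrand (C q : ℝ) : Continuous fun φ => √(C - q * sin φ ^ 2) ^ 3 := by
  fun_prop

theorem ellK_pos {C q : ℝ} (hC : 0 < C) (hq : q < C) : 0 < ellK C q :=
  intervalIntegral_pos_of_pos ((continuous_ellK_integrand hC hq).intervalIntegrable _ _)
    (fun φ => inv_pos.2 (sqrt_pos.2 (radicand_pos hC hq φ))) (by positivity)

/-- Crude, since the true growth as q tends to C is logarithmic, but it suffices for (C - q)K to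
tend to 0. -/
theorem ellK_le {C q : ℝ} (h0 : 0 ≤ q) (hq : q < C) : ellK C q ≤ π / 2 * (√(C - q))⁻¹ := by
  have hC : 0 < C := h0.trans_lt hq
  have h : ellK C q ≤ ∫ _ in (0 : ℝ)..π / 2, (√(C - q))⁻¹ := by
    refine integral_mono_on (by positivity)
      ((continuous_ellK_integrand hC hq).intervalIntegrable _ _) intervalIntegrable_const ?_
    intro φ _
    refine inv_anti₀ (sqrt_pos.2 (sub_pos.2 hq)) (sqrt_le_sqrt ?_)
    nlinarith [sin_sq_le_one φ]
  simpa using h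

theorem continuous_ellE (C : ℝ) : Continuous (ellE C) := by
  unfold ellE
  exact continuous_parametric_intervalIntegral_of_continuous' (by fun_prop) _ _

theorem ellE_zero {C : ℝ} : ellE C 0 = π / 2 * √C := by
  simp [ellE]

theorem ellK_zero {C : ℝ} : ellK C 0 = π / 2 * (√C)⁻¹ := by
  simp [ellK]

theorem ellE_self {C : ℝ} (hC : 0 < C) : ellE C C = √C := by
  have h : ∀ φ ∈ uIcc 0 (π / 2), √(C - C * sin φ ^ 2) = √C * cos φ := by
    intro φ hφ
    rw [uIcc_of_le (by positivity)] at hφ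
    have hc : 0 ≤ cos φ := cos_nonneg_of_mem_Icc ⟨by linarith [hφ.1, pi_pos], hφ.2⟩
    rw [show C - C * sin φ ^ 2 = C * cos φ ^ 2 by rw [cos_sq']; ring, sqrt_mul hC.le, sqrt_sq hc]
  rw [ellE, intervalIntegral.integral_congr h]
  simp

theorem hasDerivAt_sqrt_radicand {C q : ℝ} (hC : 0 < C) (hq : q < C) (φ : ℝ) :
    HasDerivAt (fun φ => √(C - q * sin φ ^ 2)) (-(q * sin φ * cos φ) / √(C - q * sin φ ^ 2)) φ := by
  have h : HasDerivAt (fun φ => C - q * sin φ ^ 2) (-(q * (2 * sin φ * cos φ))) φ := by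
    simpa using (((hasDerivAt_sin φ).pow 2).const_mul q).const_sub C
  refine HasDerivAt.congr_deriv (h.sqrt (radicand_ne_zero hC hq φ)) ?_
  field_simp

/-- With D the square root, the function q sin φ cos φ / D vanishes at both endpoints and has
derivative D - C(C - q)D⁻³. -/
theorem integral_inv_cube {C q : ℝ} (hC : 0 < C) (hq : q < C) :
    C * (C - q) * ∫ φ in (0 : ℝ)..π / 2, (√(C - q * sin φ ^ 2))⁻¹ ^ 3 = ellE C q := by
  have hd : ∀ φ ∈ uIcc 0 (π / 2), HasDerivAt (fun φ => q * (sin φ * cos φ) / √(C - q * sin φ ^ 2))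
      (√(C - q * sin φ ^ 2) - C * (C - q) * (√(C - q * sin φ ^ 2))⁻¹ ^ 3) φ := by
    intro φ _
    have hD := sqrt_radicand_ne_zero hC hq φ
    have hD2 := sq_sqrt (radicand_pos hC hq φ).le
    refine HasDerivAt.congr_deriv
      ((((hasDerivAt_sin φ).fun_mul (hasDerivAt_cos φ)).const_mul q).fun_div
      (hasDerivAt_sqrt_radicand hC hq φ) hD) ?_
    have hc := cos_sq' φ
    generalize √(C - q * sin φ ^ 2) = D at *
    field_simp
    simp only [hc]
    have h4 : D ^ 4 = (C - q * sin φ ^ 2) ^ 2 := by rw [← hD2]; ring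
    rw [h4, hD2]; ring
  have hi1 := (continuous_ellE_integrand C q).intervalIntegrable (μ := volume) 0 (π / 2)
  have hi2 := ((continuous_ellK_integrand_cube hC hq).const_mul (C * (C - q))).intervalIntegrable
    (μ := volume) 0 (π / 2)
  have h := integral_eq_sub_of_hasDerivAt hd (hi1.sub hi2)
  rw [intervalIntegral.integral_sub hi1 hi2, intervalIntegral.integral_const_mul] at h
  simp at h
  rw [ellE]; simp; linarith

theorem hasDerivAt_sqrt_modulus {C q : ℝ} (hC : 0 < C) (hq : q < C) (φ : ℝ) :
    HasDerivAt (fun q => √(C - q * sin φ ^ 2)) (-(sin φ ^ 2 / (2 * √(C - q * sin φ ^ 2)))) q := by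
  have h : HasDerivAt (fun q => C - q * sin φ ^ 2) (-(sin φ ^ 2)) q := by
    simpa using ((hasDerivAt_id q).mul_const (sin φ ^ 2)).const_sub C
  refine HasDerivAt.congr_deriv (h.sqrt (radicand_ne_zero hC hq φ)) ?_
  ring

theorem continuousOn_sqrt_radicand_inv {C : ℝ} (hC : 0 < C) (s : Set ℝ) :
    ContinuousOn (fun p : ℝ × ℝ => (√(C - p.1 * sin p.2 ^ 2))⁻¹) (Iio C ×ˢ s) :=
  ContinuousOn.inv₀ (by fun_prop) fun p hp => sqrt_radicand_ne_zero hC hp.1 p.2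

/-- The integrand has q-derivative -sin² φ / (2D), and q sin² φ = C - D² rewrites it as (D -
C/D)/(2q); this is why q ≠ 0 is needed. -/
theorem hasDerivAt_ellE {C q : ℝ} (hC : 0 < C) (hq : q < C) (h0 : q ≠ 0) :
    HasDerivAt (ellE C) ((ellE C q - C * ellK C q) / (2 * q)) q := by
  have h := hasDerivAt_intervalIntegral_of_continuousOn (a := 0) (b := π / 2)
    (F := fun q φ => √(C - q * sin φ ^ 2))
    (F' := fun q φ => -(sin φ ^ 2 / 2 * (√(C - q * sin φ ^ 2))⁻¹)) (Iio_mem_nhds hq)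
    (fun x _ => (continuous_ellE_integrand C x).continuousOn)
    (((by fun_prop : ContinuousOn (fun p : ℝ × ℝ => sin p.2 ^ 2 / 2) _).fun_mul
      (continuousOn_sqrt_radicand_inv hC _)).fun_neg) (fun x hx t _ => by
        refine HasDerivAt.congr_deriv (hasDerivAt_sqrt_modulus hC hx t) ?_; field_simp)
  refine h.congr_deriv ?_
  rw [ellE, ellK, ← intervalIntegral.integral_const_mul, ← intervalIntegral.integral_sub
    ((continuous_ellE_integrand C q).intervalIntegrable _ _)
    (((continuous_ellK_integrand hC hq).const_mul C).intervalIntegrable _ _),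
    ← intervalIntegral.integral_div]
  refine intervalIntegral.integral_congr fun φ _ => ?_
  have hD := sqrt_radicand_ne_zero hC hq φ
  have hD2 := sq_sqrt (radicand_pos hC hq φ).le
  generalize √(C - q * sin φ ^ 2) = D at *
  field_simp
  linarith

/-- This unreduced form has no division by q; it supplies continuity of `ellK C` at q = 0. -/
theorem hasDerivAt_ellK_integral {C q : ℝ} (hC : 0 < C) (hq : q < C) :
    HasDerivAt (ellK C) (∫ φ in (0 : ℝ)..π / 2, sin φ ^ 2 / 2 * (√(C - q * sin φ ^ 2))⁻¹ ^ 3) q :=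
  hasDerivAt_intervalIntegral_of_continuousOn (a := 0) (b := π / 2)
    (F := fun q φ => (√(C - q * sin φ ^ 2))⁻¹)
    (F' := fun q φ => sin φ ^ 2 / 2 * (√(C - q * sin φ ^ 2))⁻¹ ^ 3) (Iio_mem_nhds hq)
    (fun x hx => (continuous_ellK_integrand hC hx).continuousOn)
    ((by fun_prop : ContinuousOn (fun p : ℝ × ℝ => sin p.2 ^ 2 / 2) _).fun_mul
      ((continuousOn_sqrt_radicand_inv hC _).fun_pow 3)) (fun x hx t _ => by
        refine HasDerivAt.congr_deriv
          ((hasDerivAt_sqrt_modulus hC hx t).fun_inv (sqrt_radicand_ne_zero hC hx t)) ?_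
        field_simp)

theorem hasDerivAt_ellK {C q : ℝ} (hC : 0 < C) (hq : q < C) (h0 : q ≠ 0) :
    HasDerivAt (ellK C) ((ellE C q / (C - q) - ellK C q) / (2 * q)) q := by
  refine HasDerivAt.congr_deriv (hasDerivAt_ellK_integral hC hq) ?_
  have hCq : C - q ≠ 0 := (sub_pos.2 hq).ne'
  rw [← integral_inv_cube hC hq, mul_assoc, mul_div_assoc, mul_div_cancel_left₀ _ hCq, ellK,
    ← intervalIntegral.integral_const_mul, ← intervalIntegral.integral_sub
    (((continuous_ellK_integrand_cube hC hq).const_mul C).intervalIntegrable _ _)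
    ((continuous_ellK_integrand hC hq).intervalIntegrable _ _),
    ← intervalIntegral.integral_div]
  refine intervalIntegral.integral_congr fun φ _ => ?_
  have hD := sqrt_radicand_ne_zero hC hq φ
  have hD2 := sq_sqrt (radicand_pos hC hq φ).le
  generalize √(C - q * sin φ ^ 2) = D at *
  field_simp
  linarith

/-- Integrate the derivative of q sin φ cos φ · D, which vanishes at both endpoints. -/
theorem three_mul_ellM {C q : ℝ} (hC : 0 < C) (hq : q < C) :
    3 * ellM C q = 2 * (2 * C - q) * ellE C q - C * (C - q) * ellK C q := by
  have hd : ∀ φ ∈ uIcc 0 (π / 2), HasDerivAt (fun φ => q * (sin φ * cos φ) * √(C - q * sin φ ^ 2))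
      (3 * √(C - q * sin φ ^ 2) ^ 3 - (2 * (2 * C - q) * √(C - q * sin φ ^ 2) -
        C * (C - q) * (√(C - q * sin φ ^ 2))⁻¹)) φ := by
    intro φ _
    have hD := sqrt_radicand_ne_zero hC hq φ
    have hD2 := sq_sqrt (radicand_pos hC hq φ).le
    refine HasDerivAt.congr_deriv
      ((((hasDerivAt_sin φ).fun_mul (hasDerivAt_cos φ)).const_mul q).fun_mul
      (hasDerivAt_sqrt_radicand hC hq φ)) ?_
    have hc := cos_sq' φ
    generalize √(C - q * sin φ ^ 2) = D at *
    field_simp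
    simp only [hc]
    have h4 : D ^ 4 = (C - q * sin φ ^ 2) ^ 2 := by rw [← hD2]; ring
    rw [h4, hD2]; ring
  have hi1 := ((continuous_ellM_integrand C q).const_mul 3).intervalIntegrable
    (μ := volume) 0 (π / 2)
  have hi2 := ((continuous_ellE_integrand C q).const_mul (2 * (2 * C - q))).intervalIntegrable
    (μ := volume) 0 (π / 2)
  have hi3 := ((continuous_ellK_integrand hC hq).const_mul (C * (C - q))).intervalIntegrable
    (μ := volume) 0 (π / 2)
  have h := integral_eq_sub_of_hasDerivAt hd (hi1.sub (hi2.sub hi3))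
  rw [intervalIntegral.integral_sub hi1 (hi2.sub hi3), intervalIntegral.integral_sub hi2 hi3,
    intervalIntegral.integral_const_mul, intervalIntegral.integral_const_mul,
    intervalIntegral.integral_const_mul] at h
  simp only [cos_pi_div_two, sin_zero, mul_zero, zero_mul, sub_self] at h
  rw [ellM, ellE, ellK]; linarith

theorem hasDerivAt_comp_complement {f : ℝ → ℝ} {f' C q : ℝ} (hf : HasDerivAt f f' (C - q)) :
    HasDerivAt (fun q => f (C - q)) (-f') q := by
  simpa [Function.comp_def] using hf.comp q ((hasDerivAt_id q).const_sub C)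

theorem ellE_le {C q : ℝ} (h0 : 0 ≤ q) (hq : q < C) : ellE C q ≤ C * ellK C q := by
  have hC : 0 < C := h0.trans_lt hq
  rw [ellE, ellK, ← intervalIntegral.integral_const_mul]
  refine integral_mono_on (by positivity) ((continuous_ellE_integrand C q).intervalIntegrable _ _)
    (((continuous_ellK_integrand hC hq).const_mul C).intervalIntegrable _ _) fun φ _ => ?_
  rw [← div_eq_mul_inv, le_div_iff₀ (sqrt_pos.2 (radicand_pos hC hq φ)),
    mul_self_sqrt (radicand_pos hC hq φ).le]
  nlinarith [sq_nonneg (sin φ)]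

/-- Pointwise D² - (C - q) = q cos² φ > 0 in the open interval. The strictness makes `bandSlope`
positive. -/
theorem lt_ellE {C q : ℝ} (h0 : 0 < q) (hq : q < C) : (C - q) * ellK C q < ellE C q := by
  have hC : 0 < C := h0.trans hq
  have hi1 := (continuous_ellE_integrand C q).intervalIntegrable (μ := volume) 0 (π / 2)
  have hi2 := ((continuous_ellK_integrand hC hq).const_mul (C - q)).intervalIntegrable
    (μ := volume) 0 (π / 2)
  rw [← sub_pos, ellE, ellK, ← intervalIntegral.integral_const_mul,
    ← intervalIntegral.integral_sub hi1 hi2]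
  refine intervalIntegral_pos_of_pos_on (hi1.sub hi2) (fun φ hφ => ?_) (by positivity)
  have hc : 0 < cos φ := cos_pos_of_mem_Ioo ⟨by linarith [hφ.1, pi_pos], hφ.2⟩
  rw [sub_pos, ← div_eq_mul_inv, div_lt_iff₀ (sqrt_pos.2 (radicand_pos hC hq φ)),
    mul_self_sqrt (radicand_pos hC hq φ).le]
  nlinarith [sin_sq_add_cos_sq φ, mul_pos h0 (pow_pos hc 2)]

/-- Legendre's relation. -/
theorem legendre_relation {C q : ℝ} (h0 : 0 < q) (hq : q < C) :
    ellK C q * ellE C (C - q) + ellE C q * ellK C (C - q) - C * ellK C q * ellK C (C - q) =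
      π / 2 := by
  have hC : 0 < C := h0.trans hq
  set L : ℝ → ℝ := fun q => ellK C q * ellE C (C - q) + ellE C q * ellK C (C - q) -
    C * ellK C q * ellK C (C - q) with hL
  have hd : ∀ x ∈ Ioo 0 C, HasDerivAt L 0 x := by
    intro x hx
    have hx0 : x ≠ 0 := hx.1.ne'
    have hxC : C - x ≠ 0 := (sub_pos.2 hx.2).ne'
    have k := hasDerivAt_ellK hC hx.2 hx0
    have e := hasDerivAt_ellE hC hx.2 hx0
    have k' := hasDerivAt_comp_complement
      (hasDerivAt_ellK hC (q := C - x) (by linarith [hx.1]) hxC)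
    have e' := hasDerivAt_comp_complement
      (hasDerivAt_ellE hC (q := C - x) (by linarith [hx.1]) hxC)
    refine HasDerivAt.congr_deriv
      (((k.fun_mul e').fun_add (e.fun_mul k')).fun_sub ((k.const_mul C).fun_mul k')) ?_
    simp only [sub_sub_cancel]
    field_simp
    ring
  have hconst : ∀ x ∈ Ioo 0 C, L x = L q := by
    intro x hx
    exact (convex_Ioo 0 C).is_const_of_fderivWithin_eq_zero (𝕜 := ℝ)
      (fun y hy => (hd y hy).differentiableAt.differentiableWithinAt)
      (fun y hy => by
        rw [fderivWithin_of_isOpen isOpen_Ioo hy, (hd y hy).hasFDerivAt.fderiv]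
        ext; simp) hx ⟨h0, hq⟩
  have hlim : Tendsto L (𝓝[>] 0) (𝓝 (π / 2)) := by
    have hK : Tendsto (ellK C) (𝓝[>] 0) (𝓝 (ellK C 0)) :=
      (hasDerivAt_ellK_integral hC hC).continuousAt.tendsto.mono_left nhdsWithin_le_nhds
    have hE : Tendsto (fun x => ellE C (C - x)) (𝓝[>] 0) (𝓝 (√C)) := by
      have h := ((continuous_ellE C).comp (continuous_sub_left C)).tendsto 0
      simp only [Function.comp_def, sub_zero, ellE_self hC] at h
      exact h.mono_left nhdsWithin_le_nhds
    have hs : Tendsto (fun x : ℝ => √x) (𝓝[>] 0) (𝓝 0) := by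
      have h := continuous_sqrt.tendsto 0
      rw [sqrt_zero] at h
      exact h.mono_left nhdsWithin_le_nhds
    have hup : Tendsto (fun x => √x * (π / 2) * ellK C x) (𝓝[>] 0) (𝓝 0) := by
      simpa using (hs.mul_const (π / 2)).mul hK
    -- As q tends to 0, CK - E tends to 0 while the bound on K' blows up. The bounds 0 ≤ CK - E ≤ qK
    -- and K' ≤ π/(2√q) make the product O(√q).
    have hrem : Tendsto (fun x => (C * ellK C x - ellE C x) * ellK C (C - x)) (𝓝[>] 0) (𝓝 0) := by
      refine tendsto_of_tendsto_of_tendsto_of_le_of_le' tendsto_const_nhds hup ?_ ?_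
      · filter_upwards [Ioo_mem_nhdsGT hC] with x hx
        exact mul_nonneg (sub_nonneg.2 (ellE_le hx.1.le hx.2))
          (ellK_pos hC (by linarith [hx.1])).le
      · filter_upwards [Ioo_mem_nhdsGT hC] with x hx
        have h1 := ellK_le (C := C) (q := C - x) (by linarith [hx.2]) (by linarith [hx.1])
        rw [sub_sub_cancel] at h1
        have h2 : C * ellK C x - ellE C x ≤ x * ellK C x := by linarith [lt_ellE hx.1 hx.2]
        have hxs : √x ≠ 0 := (sqrt_pos.2 hx.1).ne'
        calc _ ≤ x * ellK C x * (π / 2 * (√x)⁻¹) :=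
              mul_le_mul h2 h1 (ellK_pos hC (by linarith [hx.1])).le
                (mul_nonneg hx.1.le (ellK_pos hC hx.2).le)
          _ = √x * √x * ellK C x * (π / 2 * (√x)⁻¹) := by rw [mul_self_sqrt hx.1.le]
          _ = _ := by field_simp
    have h := (hK.mul hE).sub hrem
    have hC' : √C ≠ 0 := (sqrt_pos.2 hC).ne'
    rw [ellK_zero, mul_assoc, inv_mul_cancel₀ hC', mul_one, sub_zero] at h
    refine h.congr fun x => ?_
    simp only [hL]
    ring
  have hlim' : Tendsto L (𝓝[>] 0) (𝓝 (L q)) := by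
    refine tendsto_const_nhds.congr' ?_
    filter_upwards [Ioo_mem_nhdsGT hC] with x hx using (hconst x hx).symm
  exact tendsto_nhds_unique hlim' hlim

/-! ### The band-edge function, its unique zero and the derivative of the zero in ξ. -/

/-- The coefficient of `ξ` in `bandFun`. -/
def bandSlope (C q : ℝ) : ℝ := ellE C q - (C - q) * ellK C q

/-- The part of `bandFun` that does not depend on `ξ`. -/
def bandConst (C q : ℝ) : ℝ := (C - q) * ellK C q * ((C + 3 * q) / 6) - ellE C q * ((C + q) / 6)

/-- The integral that determines the band edge, in terms of complete elliptic integrals. -/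
def bandFun (C ξ q : ℝ) : ℝ := ξ * bandSlope C q + bandConst C q

theorem bandSlope_pos {C q : ℝ} (h0 : 0 < q) (hq : q < C) : 0 < bandSlope C q :=
  sub_pos.2 (lt_ellE h0 hq)

theorem hasDerivAt_bandSlope {C q : ℝ} (h0 : 0 < q) (hq : q < C) :
    HasDerivAt (bandSlope C) (ellK C q / 2) q := by
  have hC : 0 < C := h0.trans hq
  refine ((hasDerivAt_ellE hC hq h0.ne').fun_sub
    (((hasDerivAt_id' q).const_sub C).fun_mul (hasDerivAt_ellK hC hq h0.ne'))).congr_deriv ?_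
  have h1 : C - q ≠ 0 := (sub_pos.2 hq).ne'
  field_simp
  ring

theorem hasDerivAt_bandConst {C q : ℝ} (h0 : 0 < q) (hq : q < C) :
    HasDerivAt (bandConst C) ((C / 2 - 3 * q / 2) * ellK C q / 2) q := by
  have hC : 0 < C := h0.trans hq
  have hl1 : HasDerivAt (fun q : ℝ => (C + 3 * q) / 6) (3 / 6) q := by
    simpa using (((hasDerivAt_id' q).const_mul 3).const_add C).div_const 6
  have hl2 : HasDerivAt (fun q : ℝ => (C + q) / 6) (1 / 6) q :=
    ((hasDerivAt_id' q).const_add C).div_const 6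
  refine (((((hasDerivAt_id' q).const_sub C).fun_mul (hasDerivAt_ellK hC hq h0.ne')).fun_mul
    hl1).fun_sub ((hasDerivAt_ellE hC hq h0.ne').fun_mul hl2)).congr_deriv ?_
  have h1 : C - q ≠ 0 := (sub_pos.2 hq).ne'
  field_simp
  ring

/-- All E-terms cancel, so the sign of the derivative is that of a linear function of q. -/
theorem hasDerivAt_bandFun {C ξ q : ℝ} (h0 : 0 < q) (hq : q < C) :
    HasDerivAt (bandFun C ξ) ((ξ + C / 2 - 3 * q / 2) * ellK C q / 2) q := by
  refine (((hasDerivAt_bandSlope h0 hq).const_mul ξ).fun_add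
    (hasDerivAt_bandConst h0 hq)).congr_deriv ?_
  ring

theorem continuousOn_bandFun {C ξ : ℝ} (hC : 0 < C) : ContinuousOn (bandFun C ξ) (Iio C) := by
  have hK : ContinuousOn (ellK C) (Iio C) := fun q hq =>
    (hasDerivAt_ellK_integral hC hq).continuousAt.continuousWithinAt
  have hE : ContinuousOn (ellE C) (Iio C) := (continuous_ellE C).continuousOn
  unfold bandFun bandSlope bandConst
  fun_prop

theorem bandFun_zero {C ξ : ℝ} (hC : 0 < C) : bandFun C ξ 0 = 0 := by
  have h : √C ≠ 0 := (sqrt_pos.2 hC).ne'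
  have h2 : C = √C * √C := (mul_self_sqrt hC.le).symm
  have h3 : C * (√C)⁻¹ = √C := by
    nth_rewrite 1 [h2]; field_simp
  have h4 : ellE C 0 = C * ellK C 0 := by
    rw [ellE_zero, ellK_zero, mul_left_comm, h3]
  rw [bandFun, bandSlope, bandConst, h4]
  ring

/-- Here E tends to √C and (C - q)K to 0. The limit is negative exactly when ξ < C/3, the upper end
of the admissible range. -/
theorem tendsto_bandFun {C ξ : ℝ} (hC : 0 < C) :
    Tendsto (bandFun C ξ) (𝓝[<] C) (𝓝 (√C * (ξ - C / 3))) := by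
  have hE : Tendsto (ellE C) (𝓝[<] C) (𝓝 (√C)) := by
    have h := (continuous_ellE C).tendsto C
    rw [ellE_self hC] at h
    exact h.mono_left nhdsWithin_le_nhds
  have hup : Tendsto (fun q => √(C - q) * (π / 2)) (𝓝[<] C) (𝓝 0) := by
    have h : Continuous fun q => √(C - q) * (π / 2) := by fun_prop
    have h := h.tendsto C
    simp only [sub_self, sqrt_zero, zero_mul] at h
    exact h.mono_left nhdsWithin_le_nhds
  have hK : Tendsto (fun q => (C - q) * ellK C q) (𝓝[<] C) (𝓝 0) := by
    refine tendsto_of_tendsto_of_tendsto_of_le_of_le' tendsto_const_nhds hup ?_ ?_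
    · filter_upwards [Ioo_mem_nhdsLT hC] with q hq
      exact mul_nonneg (sub_pos.2 hq.2).le (ellK_pos hC hq.2).le
    · filter_upwards [Ioo_mem_nhdsLT hC] with q hq
      have hs : √(C - q) ≠ 0 := (sqrt_pos.2 (sub_pos.2 hq.2)).ne'
      calc (C - q) * ellK C q ≤ (C - q) * (π / 2 * (√(C - q))⁻¹) :=
            mul_le_mul_of_nonneg_left (ellK_le hq.1.le hq.2) (sub_pos.2 hq.2).le
        _ = √(C - q) * √(C - q) * (π / 2 * (√(C - q))⁻¹) := by
            rw [mul_self_sqrt (sub_pos.2 hq.2).le]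
        _ = _ := by field_simp
  have hid : Tendsto (fun q : ℝ => q) (𝓝[<] C) (𝓝 C) := tendsto_id.mono_left nhdsWithin_le_nhds
  have h := ((hE.sub hK).const_mul ξ).add ((hK.mul (((hid.const_mul 3).const_add C).div_const 6)).sub
    (hE.mul ((hid.const_add C).div_const 6)))
  refine (h.congr fun q => rfl).trans_eq ?_
  congr 1
  ring

/-- For `ξ` in the admissible range, `bandFun C ξ` has one zero in `(0, C)`, where it changes its
sign from plus to minus. -/
theorem exists_bandFun_zero {C ξ : ℝ} (hC : 0 < C) (hξ : ξ ∈ Ioo (-C / 2) (C / 3)) :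
    ∃ q ∈ Ioo 0 C, bandFun C ξ q = 0 ∧ ξ + C / 2 - 3 * q / 2 < 0 ∧
      (∀ p ∈ Ioo 0 q, 0 < bandFun C ξ p) ∧ ∀ p ∈ Ioo q C, bandFun C ξ p < 0 := by
  obtain ⟨hξ1, hξ2⟩ := hξ
  -- The critical point of `bandFun`, where the linear factor vanishes; ξ > -C/2 gives m > 0.
  set m : ℝ := 2 / 3 * (ξ + C / 2) with hm
  have hm0 : 0 < m := by linarith
  have hmC : m < C := by linarith
  have hcont := continuousOn_bandFun (ξ := ξ) hC
  have hmono : StrictMonoOn (bandFun C ξ) (Icc 0 m) := by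
    refine strictMonoOn_of_deriv_pos (convex_Icc 0 m)
      (hcont.mono fun p hp => hp.2.trans_lt hmC) fun p hp => ?_
    rw [interior_Icc] at hp
    rw [(hasDerivAt_bandFun hp.1 (hp.2.trans hmC)).deriv]
    have := ellK_pos hC (hp.2.trans hmC)
    have : 0 < ξ + C / 2 - 3 * p / 2 := by linarith [hp.2]
    positivity
  have hanti : StrictAntiOn (bandFun C ξ) (Ico m C) := by
    refine strictAntiOn_of_deriv_neg (convex_Ico m C)
      (hcont.mono fun p hp => hp.2) fun p hp => ?_
    rw [interior_Ico] at hp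
    rw [(hasDerivAt_bandFun (hm0.trans hp.1) hp.2).deriv]
    have := ellK_pos hC hp.2
    have : ξ + C / 2 - 3 * p / 2 < 0 := by linarith [hp.1]
    have := mul_neg_of_neg_of_pos this (ellK_pos hC hp.2)
    linarith
  have hpos : ∀ p ∈ Ioc 0 m, 0 < bandFun C ξ p := fun p hp => by
    simpa [bandFun_zero hC] using hmono ⟨le_rfl, hm0.le⟩ ⟨hp.1.le, hp.2⟩ hp.1
  have hlim : √C * (ξ - C / 3) < 0 := mul_neg_of_pos_of_neg (sqrt_pos.2 hC) (by linarith)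
  obtain ⟨r, hr, hrm⟩ := (((tendsto_bandFun (ξ := ξ) hC).eventually_lt_const hlim).and
    (Ioo_mem_nhdsLT hmC)).exists
  obtain ⟨q, hq, hq0⟩ := intermediate_value_Ioo' hrm.1.le
    (hcont.mono fun p hp => hp.2.trans_lt hrm.2) ⟨hr, hpos m ⟨hm0, le_rfl⟩⟩
  have hqC : q < C := hq.2.trans hrm.2
  refine ⟨q, ⟨hm0.trans hq.1, hqC⟩, hq0, by linarith [hq.1], fun p hp => ?_, fun p hp => ?_⟩
  · rcases le_or_gt p m with h | h
    · exact hpos p ⟨hp.1, h⟩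
    · simpa [hq0] using hanti ⟨h.le, hp.2.trans hqC⟩ ⟨hq.1.le, hqC⟩ hp.2
  · simpa [hq0] using hanti ⟨hq.1.le, hqC⟩ ⟨(hq.1.trans hp.1).le, hp.2⟩ hp.1

/-- Implicit differentiation of the zero of `bandFun`. -/
theorem hasDerivAt_bandFun_zero {C ξ : ℝ} {g : ℝ → ℝ} (hC : 0 < C)
    (hξ : ξ ∈ Ioo (-C / 2) (C / 3))
    (hg : ∀ η ∈ Ioo (-C / 2) (C / 3), g η ∈ Ioo 0 C ∧ bandFun C η (g η) = 0) :
    ξ + C / 2 - 3 * g ξ / 2 < 0 ∧ HasDerivAt g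
      (-(2 * bandSlope C (g ξ)) / ((ξ + C / 2 - 3 * g ξ / 2) * ellK C (g ξ))) ξ := by
  have hnhds : Ioo (-C / 2) (C / 3) ∈ 𝓝 ξ := Ioo_mem_nhds hξ.1 hξ.2
  -- The sign of `bandFun C η` at a test point p tells on which side of p the zero g η lies. For
  -- fixed p this sign is stable under small changes of η, which yields the continuity of g.
  have key : ∀ η ∈ Ioo (-C / 2) (C / 3), η + C / 2 - 3 * g η / 2 < 0 ∧
      (∀ p ∈ Ioo 0 C, 0 < bandFun C η p → p < g η) ∧
      (∀ p ∈ Ioo 0 C, bandFun C η p < 0 → g η < p) ∧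
      (∀ p ∈ Ioo 0 (g η), 0 < bandFun C η p) ∧ ∀ p ∈ Ioo (g η) C, bandFun C η p < 0 := by
    intro η hη
    obtain ⟨q, hq, hq0, hneg, hl, hr⟩ := exists_bandFun_zero hC hη
    have hgq : g η = q := by
      rcases lt_trichotomy (g η) q with h | h | h
      · exact absurd (hg η hη).2 (hl _ ⟨(hg η hη).1.1, h⟩).ne'
      · exact h
      · exact absurd (hg η hη).2 (hr _ ⟨h, (hg η hη).1.2⟩).ne
    rw [hgq]
    refine ⟨hneg, fun p hp h => ?_, fun p hp h => ?_, hl, hr⟩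
    · by_contra! hle
      rcases hle.eq_or_lt with rfl | hlt
      · exact h.ne' hq0
      · exact lt_asymm h (hr p ⟨hlt, hp.2⟩)
    · by_contra! hle
      rcases hle.eq_or_lt with rfl | hlt
      · exact h.ne hq0
      · exact lt_asymm h (hl p ⟨hp.1, hlt⟩)
  have hcontξ : ∀ p, Continuous fun η => bandFun C η p := fun p => by
    unfold bandFun; fun_prop
  obtain ⟨hneg, -, -, hl, hr⟩ := key ξ hξ
  obtain ⟨⟨hq0, hqC⟩, hzero⟩ := hg ξ hξ
  have hcont : ContinuousAt g ξ := by
    refine tendsto_order.2 ⟨fun b hb => ?_, fun b hb => ?_⟩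
    · obtain ⟨p, hp1, hp2⟩ := exists_between (max_lt hq0 hb)
      have hp0 : 0 < p := (le_max_left _ _).trans_lt hp1
      have hev := ((hcontξ p).tendsto ξ).eventually_const_lt (hl p ⟨hp0, hp2⟩)
      filter_upwards [hev, hnhds] with η h1 h2
      exact ((le_max_right _ _).trans_lt hp1).trans ((key η h2).2.1 p ⟨hp0, hp2.trans hqC⟩ h1)
    · obtain ⟨p, hp1, hp2⟩ := exists_between (lt_min hqC hb)
      have hpC : p < C := hp2.trans_le (min_le_left _ _)
      have hev := ((hcontξ p).tendsto ξ).eventually_lt_const (hr p ⟨hp1, hpC⟩)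
      filter_upwards [hev, hnhds] with η h1 h2
      exact ((key η h2).2.2.1 p ⟨hq0.trans hp1, hpC⟩ h1).trans (hp2.trans_le (min_le_right _ _))
  refine ⟨hneg, ?_⟩
  have hS := bandSlope_pos hq0 hqC
  have hK := ellK_pos (q := g ξ) hC hqC
  -- `bandFun` is affine in ξ, so g is locally inverted by q ↦ -`bandConst`/`bandSlope`, and the
  -- inverse function rule applies.
  have hinv := (hasDerivAt_bandConst hq0 hqC).fun_neg.fun_div (hasDerivAt_bandSlope hq0 hqC) hS.ne'
  have hder : -((C / 2 - 3 * g ξ / 2) * ellK C (g ξ) / 2) * bandSlope C (g ξ) -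
      -bandConst C (g ξ) * (ellK C (g ξ) / 2) =
      -((ξ + C / 2 - 3 * g ξ / 2) * ellK C (g ξ) / 2) * bandSlope C (g ξ) := by
    have : bandConst C (g ξ) = -(ξ * bandSlope C (g ξ)) := by
      rw [bandFun] at hzero; linarith
    rw [this]; ring
  rw [hder] at hinv
  have hne : -((ξ + C / 2 - 3 * g ξ / 2) * ellK C (g ξ) / 2) * bandSlope C (g ξ) /
      bandSlope C (g ξ) ^ 2 ≠ 0 := by
    have : ξ + C / 2 - 3 * g ξ / 2 ≠ 0 := hneg.ne
    have := hS.ne'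
    have := hK.ne'
    simp only [ne_eq, div_eq_zero_iff, mul_eq_zero, neg_eq_zero, not_or]
    exact ⟨⟨⟨⟨by assumption, by assumption⟩, by norm_num⟩, by assumption⟩, by simpa⟩
  have hres := HasDerivAt.of_local_left_inverse hcont hinv hne (by
    filter_upwards [hnhds] with η hη
    obtain ⟨⟨h0, h1⟩, h2⟩ := hg η hη
    rw [div_eq_iff (bandSlope_pos h0 h1).ne']
    rw [bandFun] at h2; linarith)
  refine hres.congr_deriv ?_
  have h1 : ξ + C / 2 - 3 * g ξ / 2 ≠ 0 := hneg.ne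
  have h2 := hS.ne'
  have h3 := hK.ne'
  generalize ξ + C / 2 - 3 * g ξ / 2 = w at *
  field_simp

/-! ### Principal square roots and the collapse of a contour onto a cut. -/

theorem cpow_half_sq (z : ℂ) : (z ^ (1 / 2 : ℂ)) ^ 2 = z := by
  rw [one_div]
  exact Complex.cpow_ofNat_inv_pow z 2

/-- The principal root has argument in (-π/2, π/2]. Together with `cpow_half_sq` this allows arguing
with real and imaginary parts only. -/
theorem cpow_half_re_im (z : ℂ) :
    0 ≤ (z ^ (1 / 2 : ℂ)).re ∧ ((z ^ (1 / 2 : ℂ)).re = 0 → 0 ≤ (z ^ (1 / 2 : ℂ)).im) := by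
  rcases eq_or_ne z 0 with rfl | hz
  · simp
  have him : (Complex.log z * (1 / 2)).im = z.arg / 2 := by
    rw [show (1 / 2 : ℂ) = ((1 / 2 : ℝ) : ℂ) by norm_num, Complex.im_mul_ofReal, Complex.log_im]
    ring
  have h1 := Complex.neg_pi_lt_arg z
  have h2 := Complex.arg_le_pi z
  rw [Complex.cpow_def_of_ne_zero hz, Complex.exp_re, Complex.exp_im, him]
  refine ⟨mul_nonneg (exp_pos _).le (cos_nonneg_of_mem_Icc ⟨by linarith, by linarith⟩),
    fun h => mul_nonneg (exp_pos _).le ?_⟩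
  rcases mul_eq_zero.1 h with h | h
  · exact absurd h (exp_pos _).ne'
  · rcases le_or_gt 0 z.arg with h0 | h0
    · exact sin_nonneg_of_nonneg_of_le_pi (by linarith) (by linarith)
    · exact absurd h (cos_pos_of_mem_Ioo ⟨by linarith, by linarith⟩).ne'

theorem cpow_half_ofReal {x : ℝ} (hx : 0 ≤ x) : (x : ℂ) ^ (1 / 2 : ℂ) = (√x : ℝ) := by
  rw [sqrt_eq_rpow, Complex.ofReal_cpow hx]
  norm_num

theorem cpow_half_ofReal_of_nonpos {x : ℝ} (hx : x ≤ 0) :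
    (x : ℂ) ^ (1 / 2 : ℂ) = Complex.I * (√(-x) : ℝ) := by
  rcases hx.eq_or_lt with rfl | hx
  · simp
  have h1 : (x : ℂ) ≠ 0 := Complex.ofReal_ne_zero.2 hx.ne
  have h2 : ((-x : ℝ) : ℂ) ≠ 0 := Complex.ofReal_ne_zero.2 (neg_pos.2 hx).ne'
  rw [← cpow_half_ofReal (neg_pos.2 hx).le, Complex.cpow_def_of_ne_zero h1,
    Complex.cpow_def_of_ne_zero h2]
  have h3 : Complex.log x = Complex.log ((-x : ℝ) : ℂ) + π * Complex.I := by
    rw [Complex.log, Complex.log, Complex.arg_ofReal_of_neg hx,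
      Complex.arg_ofReal_of_nonneg (neg_pos.2 hx).le]
    simp
  rw [h3, add_mul, Complex.exp_add, mul_comm]
  congr 1
  rw [show (π : ℂ) * Complex.I * (1 / 2) = π / 2 * Complex.I by ring, Complex.exp_pi_div_two_mul_I]

/-- The principal roots of `l + C` and `l + q` lie in a common half plane when `l` is off the
cut `[-C, -q]`. -/
theorem cpow_half_mul_conj_re_pos {C q : ℝ} (hq : q < C) {l : ℂ}
    (hl : l.im ≠ 0 ∨ l.re < -C ∨ -q < l.re) :
    0 < ((l + C) ^ (1 / 2 : ℂ) * (starRingEnd ℂ) ((l + q) ^ (1 / 2 : ℂ))).re := by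
  have s1 := cpow_half_sq (l + C)
  have s2 := cpow_half_sq (l + q)
  obtain ⟨r1, i1⟩ := cpow_half_re_im (l + C)
  obtain ⟨r2, i2⟩ := cpow_half_re_im (l + q)
  set u := (l + C) ^ (1 / 2 : ℂ)
  set v := (l + q) ^ (1 / 2 : ℂ)
  have s1re := congrArg Complex.re s1
  have s1im := congrArg Complex.im s1
  have s2re := congrArg Complex.re s2
  have s2im := congrArg Complex.im s2
  simp only [sq, Complex.mul_re, Complex.mul_im, Complex.add_re, Complex.add_im, Complex.ofReal_re,
    Complex.ofReal_im] at s1re s1im s2re s2im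
  simp only [Complex.mul_re, Complex.conj_re, Complex.conj_im]
  have key : 0 < u.re * v.re + u.im * v.im := by
    by_cases him : l.im = 0
    · rcases hl with h | h | h
      · exact absurd him h
      · have hu : u.re = 0 := by
          by_contra hne
          have h1 : u.im = 0 := by
            have : u.re * u.im = 0 := by linarith
            exact (mul_eq_zero.1 this).resolve_left hne
          rw [h1] at s1re
          nlinarith [mul_self_nonneg u.re]
        have hv : v.re = 0 := by
          by_contra hne
          have h1 : v.im = 0 := by
            have : v.re * v.im = 0 := by linarith
            exact (mul_eq_zero.1 this).resolve_left hne
          rw [h1] at s2re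
          nlinarith [mul_self_nonneg v.re]
        have hu' : 0 < u.im := (i1 hu).lt_of_ne' fun h0 => by
          rw [hu, h0] at s1re; linarith
        have hv' : 0 < v.im := (i2 hv).lt_of_ne' fun h0 => by
          rw [hv, h0] at s2re; linarith
        rw [hu, hv]
        have := mul_pos hu' hv'
        linarith
      · have hu : 0 < u.re := r1.lt_of_ne' fun h0 => by
          rw [h0] at s1re; nlinarith [mul_self_nonneg u.im]
        have hv : 0 < v.re := r2.lt_of_ne' fun h0 => by
          rw [h0] at s2re; nlinarith [mul_self_nonneg v.im]
        have hu' : u.im = 0 := by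
          have : u.re * u.im = 0 := by linarith
          exact (mul_eq_zero.1 this).resolve_left hu.ne'
        rw [hu']
        have := mul_pos hu hv
        linarith
    · have hu : 0 < u.re := r1.lt_of_ne' fun h0 => him (by rw [h0] at s1im; linarith)
      have hv : 0 < v.re := r2.lt_of_ne' fun h0 => him (by rw [h0] at s2im; linarith)
      -- Both squares have imaginary part Im l, so the roots have imaginary parts of the same sign.
      have h1 : (u.re * v.re) * (u.im * v.im) = (l.im / 2) ^ 2 := by
        have e1 : u.re * u.im = l.im / 2 := by linarith
        have e2 : v.re * v.im = l.im / 2 := by linarith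
        calc _ = (u.re * u.im) * (v.re * v.im) := by ring
          _ = _ := by rw [e1, e2]; ring
      have h2 : 0 ≤ u.im * v.im :=
        le_of_mul_le_mul_left (by rw [h1, mul_zero]; positivity) (mul_pos hu hv)
      linarith [mul_pos hu hv]
  linarith

/-- The Stieltjes transform of the arcsine law, in terms of the two square roots. -/
theorem integral_inv_sub_cos {u v : ℂ} (h : 0 < (u * (starRingEnd ℂ) v).re) :
    ∫ θ in (0 : ℝ)..2 * π, ((u ^ 2 + v ^ 2) / 2 - (u ^ 2 - v ^ 2) / 2 * Real.cos θ)⁻¹ =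
      2 * π * (u * v)⁻¹ := by
  have hn : ‖u - v‖ < ‖u + v‖ := by
    rw [← sq_lt_sq₀ (norm_nonneg _) (norm_nonneg _), ← Complex.normSq_eq_norm_sq,
      ← Complex.normSq_eq_norm_sq, Complex.normSq_sub, Complex.normSq_add]
    linarith
  have hu : u ≠ 0 := by rintro rfl; simp at h
  have hv : v ≠ 0 := by rintro rfl; simp at h
  have hs : u + v ≠ 0 := norm_pos_iff.1 ((norm_nonneg _).trans_lt hn)
  -- With ζ = e^{iθ} the denominator is (u + v)²/4 · (ζ - w)(1 - wζ)/ζ. As |w| < 1, Cauchy's formula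
  -- evaluates (1 - wζ)⁻¹ at w.
  set w : ℂ := (u - v) / (u + v) with hw
  have hw1 : ‖w‖ < 1 := by
    rw [hw, norm_div]
    exact (div_lt_one (norm_pos_iff.2 hs)).2 hn
  have hne : ∀ ζ : ℂ, ‖ζ‖ ≤ 1 → 1 - w * ζ ≠ 0 := fun ζ hζ h0 => by
    have h1 : w * ζ = 1 := (sub_eq_zero.1 h0).symm
    have h2 : ‖w * ζ‖ < 1 := by
      rw [norm_mul]
      calc ‖w‖ * ‖ζ‖ ≤ ‖w‖ * 1 := mul_le_mul_of_nonneg_left hζ (norm_nonneg _)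
        _ < 1 := by linarith
    rw [h1] at h2
    simp at h2
  have hdiff : DifferentiableOn ℂ (fun ζ : ℂ => (1 - w * ζ)⁻¹) (Metric.closedBall 0 1) := by
    refine DifferentiableOn.fun_inv (by fun_prop) fun ζ hζ => hne ζ (by simpa using hζ)
  have hc := hdiff.circleIntegral_sub_inv_smul (w := w) (by simpa using hw1)
  rw [circleIntegral] at hc
  have hint : ∀ θ : ℝ, ((u ^ 2 + v ^ 2) / 2 - (u ^ 2 - v ^ 2) / 2 * Real.cos θ)⁻¹ =
      4 / (u + v) ^ 2 / Complex.I * (deriv (circleMap 0 1) θ • ((circleMap 0 1 θ - w)⁻¹ •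
        (1 - w * circleMap 0 1 θ)⁻¹)) := by
    intro θ
    have hz : circleMap 0 1 θ ≠ 0 := circleMap_ne_center one_ne_zero
    have hz1 : ‖circleMap 0 1 θ‖ = 1 := by simp
    have hcos : (Real.cos θ : ℂ) = (circleMap 0 1 θ + (circleMap 0 1 θ)⁻¹) / 2 := by
      rw [Complex.ofReal_cos, Complex.cos]
      simp [circleMap, ← Complex.exp_neg]
    rw [deriv_circleMap, hcos]
    generalize circleMap 0 1 θ = ζ at *
    have h1 : 1 - w * ζ ≠ 0 := hne ζ hz1.le
    have h2 : ζ - w ≠ 0 := fun h0 => by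
      rw [sub_eq_zero.1 h0] at hz1
      exact hw1.ne hz1
    have hfac : (u ^ 2 + v ^ 2) / 2 - (u ^ 2 - v ^ 2) / 2 * ((ζ + ζ⁻¹) / 2) =
        (u + v) ^ 2 / 4 * ((ζ - w) * (1 - w * ζ)) / ζ := by
      rw [hw]
      field_simp
      ring
    rw [hfac, smul_eq_mul, smul_eq_mul]
    have hI := Complex.I_ne_zero
    field_simp
  simp_rw [hint]
  rw [intervalIntegral.integral_const_mul, hc, smul_eq_mul]
  have h3 : 1 - w * w = 4 * (u * v) / (u + v) ^ 2 := by
    rw [hw]; field_simp; ring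
  rw [h3]
  have hI := Complex.I_ne_zero
  field_simp

/-- Collapse of a circle around the cut `[-C, -q]` to an integral over the cut. -/
theorem circleIntegral_collapse {C q ρ : ℝ} (hq : q < C) (hρ : (C - q) / 2 < ρ) {g : ℂ → ℂ}
    (hg : DifferentiableOn ℂ g (Metric.closedBall ((-(C + q) / 2 : ℝ) : ℂ) ρ)) :
    (∮ l in C(((-(C + q) / 2 : ℝ) : ℂ), ρ),
      g l * ((l + C) ^ (1 / 2 : ℂ) * (l + q) ^ (1 / 2 : ℂ))⁻¹) =
      Complex.I * ∫ θ in (0 : ℝ)..2 * π, g ((-(C + q) / 2 + (C - q) / 2 * Real.cos θ : ℝ) : ℂ) := by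
  set m : ℝ := -(C + q) / 2 with hm
  set r : ℝ := (C - q) / 2 with hr
  have hr0 : 0 < r := by rw [hr]; linarith
  have hρ0 : 0 < ρ := hr0.trans hρ
  have hball : ∀ θ : ℝ, ((m + r * Real.cos θ : ℝ) : ℂ) ∈ Metric.ball (m : ℂ) ρ := by
    intro θ
    rw [Metric.mem_ball, Complex.dist_eq, ← Complex.ofReal_sub, Complex.norm_real, norm_eq_abs,
      add_sub_cancel_left, abs_mul, abs_of_pos hr0]
    nlinarith [abs_cos_le_one θ]
  have hoff : ∀ t : ℝ, (circleMap m ρ t).im ≠ 0 ∨ (circleMap m ρ t).re < -C ∨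
      -q < (circleMap m ρ t).re := by
    intro t
    by_contra! hcon
    obtain ⟨h1, h2, h3⟩ := hcon
    have h4 : ‖circleMap m ρ t - m‖ = ρ := by simp [abs_of_pos hρ0]
    have h5 : circleMap m ρ t - m = (((circleMap m ρ t).re - m : ℝ) : ℂ) := by
      apply Complex.ext
      · simp only [Complex.sub_re, Complex.ofReal_re]
      · simp only [Complex.sub_im, Complex.ofReal_im, h1, sub_self]
    rw [h5, Complex.norm_real, norm_eq_abs] at h4
    have : |(circleMap m ρ t).re - m| ≤ r := abs_le.2 ⟨by linarith, by linarith⟩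
    linarith
  have hne : ∀ t θ : ℝ, circleMap m ρ t - ((m + r * Real.cos θ : ℝ) : ℂ) ≠ 0 := by
    intro t θ h0
    have h1 := hball θ
    rw [← sub_eq_zero.1 h0] at h1
    have h2 := Metric.mem_sphere.1 (circleMap_mem_sphere (m : ℂ) hρ0.le t)
    exact (Metric.mem_ball.1 h1).ne h2
  -- The inverse root is an average of Cauchy kernels with poles on the cut. After Fubini, Cauchy's
  -- formula replaces the circle integral of g against each kernel by the value of g at its pole.
  have hroot : ∀ t : ℝ, 2 * π * ((circleMap m ρ t + C) ^ (1 / 2 : ℂ) *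
      (circleMap m ρ t + q) ^ (1 / 2 : ℂ))⁻¹ =
      ∫ θ in (0 : ℝ)..2 * π, (circleMap m ρ t - ((m + r * Real.cos θ : ℝ) : ℂ))⁻¹ := by
    intro t
    rw [← integral_inv_sub_cos (cpow_half_mul_conj_re_pos hq (hoff t)), cpow_half_sq, cpow_half_sq]
    refine intervalIntegral.integral_congr fun θ _ => ?_
    simp only [hm, hr]
    push_cast
    congr 1
    ring
  have hgc : Continuous fun t => g (circleMap m ρ t) :=
    hg.continuousOn.comp_continuous (continuous_circleMap _ _)
      fun t => circleMap_mem_closedBall _ hρ0.le t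
  have hpi : (2 * π : ℂ) ≠ 0 := by exact_mod_cast two_pi_pos.ne'
  have hF : Continuous (Function.uncurry fun t θ : ℝ => deriv (circleMap m ρ) t •
      ((circleMap m ρ t - ((m + r * Real.cos θ : ℝ) : ℂ))⁻¹ • g (circleMap m ρ t))) := by
    have h1 : Continuous fun p : ℝ × ℝ => deriv (circleMap m ρ) p.1 := by
      simp only [deriv_circleMap]
      fun_prop
    have h2 : Continuous fun p : ℝ × ℝ =>
        (circleMap m ρ p.1 - ((m + r * Real.cos p.2 : ℝ) : ℂ))⁻¹ :=
      Continuous.inv₀ (by fun_prop) fun p => hne p.1 p.2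
    exact h1.smul (h2.smul (hgc.comp continuous_fst))
  have hswap := intervalIntegral_intervalIntegral_swap (a := 0) (b := 2 * π) (c := 0) (d := 2 * π)
    (F := fun t θ : ℝ => deriv (circleMap m ρ) t •
      ((circleMap m ρ t - ((m + r * Real.cos θ : ℝ) : ℂ))⁻¹ • g (circleMap m ρ t))) 
    ((hF.continuousOn.integrableOn_compact (isCompact_uIcc.prod isCompact_uIcc)).mono_set
      (prod_mono uIoc_subset_uIcc uIoc_subset_uIcc))
  rw [← mul_right_inj' hpi]
  calc 2 * (π : ℂ) * ∮ l in C((m : ℂ), ρ), g l * ((l + C) ^ (1 / 2 : ℂ) * (l + q) ^ (1 / 2 : ℂ))⁻¹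
      = ∫ t in (0 : ℝ)..2 * π, ∫ θ in (0 : ℝ)..2 * π, deriv (circleMap m ρ) t •
        ((circleMap m ρ t - ((m + r * Real.cos θ : ℝ) : ℂ))⁻¹ • g (circleMap m ρ t)) := by
        rw [circleIntegral, ← intervalIntegral.integral_const_mul]
        refine intervalIntegral.integral_congr fun t _ => ?_
        simp only [smul_eq_mul]
        rw [intervalIntegral.integral_const_mul, intervalIntegral.integral_mul_const, ← hroot t]
        ring
    _ = ∫ θ in (0 : ℝ)..2 * π, (2 * π * Complex.I) * g ((m + r * Real.cos θ : ℝ) : ℂ) := by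
        rw [hswap]
        refine intervalIntegral.integral_congr fun θ _ => ?_
        exact hg.circleIntegral_sub_inv_smul (hball θ)
    _ = _ := by rw [intervalIntegral.integral_const_mul]; ring

/-! ### Reduction of the periods and of the integrals over s to K, E and `ellM`. -/

theorem integral_quadratic {C q : ℝ} (hC : 0 < C) (hq : q < C) (x₀ x₁ x₂ : ℂ) :
    ∫ φ in (0 : ℝ)..π / 2, (x₀ + x₁ * (√(C - q * sin φ ^ 2) : ℂ) ^ 2 +
      x₂ * (√(C - q * sin φ ^ 2) : ℂ) ^ 4) / (√(C - q * sin φ ^ 2) : ℂ) =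
      x₀ * ellK C q + x₁ * ellE C q + x₂ * ellM C q := by
  have hk : Continuous fun φ => (((√(C - q * sin φ ^ 2))⁻¹ : ℝ) : ℂ) :=
    Complex.continuous_ofReal.comp (continuous_ellK_integrand hC hq)
  have he : Continuous fun φ => ((√(C - q * sin φ ^ 2) : ℝ) : ℂ) := by fun_prop
  have hm : Continuous fun φ => ((√(C - q * sin φ ^ 2) ^ 3 : ℝ) : ℂ) := by fun_prop
  rw [ellK, ellE, ellM, ← intervalIntegral.integral_ofReal, ← intervalIntegral.integral_ofReal,
    ← intervalIntegral.integral_ofReal, ← intervalIntegral.integral_const_mul,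
    ← intervalIntegral.integral_const_mul, ← intervalIntegral.integral_const_mul,
    ← intervalIntegral.integral_add ((hk.const_mul _).intervalIntegrable _ _)
      ((he.const_mul _).intervalIntegrable _ _),
    ← intervalIntegral.integral_add (((hk.const_mul _).fun_add (he.const_mul _)).intervalIntegrable _ _)
      ((hm.const_mul _).intervalIntegrable _ _)]
  refine intervalIntegral.integral_congr fun φ _ => ?_
  have hD : (√(C - q * sin φ ^ 2) : ℂ) ≠ 0 :=
    Complex.ofReal_ne_zero.2 (sqrt_radicand_ne_zero hC hq φ)
  simp only [Complex.ofReal_inv, Complex.ofReal_pow]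
  generalize (√(C - q * sin φ ^ 2) : ℂ) = D at *
  field_simp

theorem integral_quadratic_real {C q : ℝ} (hC : 0 < C) (hq : q < C) (x₀ x₁ x₂ : ℝ) :
    ∫ φ in (0 : ℝ)..π / 2, (x₀ + x₁ * √(C - q * sin φ ^ 2) ^ 2 +
      x₂ * √(C - q * sin φ ^ 2) ^ 4) / √(C - q * sin φ ^ 2) =
      x₀ * ellK C q + x₁ * ellE C q + x₂ * ellM C q := by
  have h := integral_quadratic hC hq x₀ x₁ x₂
  rw [← Complex.ofReal_inj, ← intervalIntegral.integral_ofReal]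
  push_cast
  exact h

theorem sin_cos_pos_of_mem {φ : ℝ} (hφ : φ ∈ Ioo 0 (π / 2)) : 0 < sin φ ∧ 0 < cos φ :=
  ⟨sin_pos_of_pos_of_lt_pi hφ.1 (by linarith [hφ.2, pi_pos]),
    cos_pos_of_mem_Ioo ⟨by linarith [hφ.1, pi_pos], hφ.2⟩⟩

theorem mem_Ioo_of_min_max {φ : ℝ} (hφ : φ ∈ Ioo (min 0 (π / 2)) (max 0 (π / 2))) :
    φ ∈ Ioo 0 (π / 2) := by
  rwa [min_eq_left (by positivity), max_eq_right (by positivity)] at hφ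

/-- On the gap the radicands of the three principal roots are positive, so R is i times a positive
number. -/
theorem R_on_gap {c α : ℝ} (hα : 0 < α) (hαc : α < c) {φ : ℝ} (hφ : φ ∈ Ioo 0 (π / 2)) :
    R c α ((-(α ^ 2 * sin φ ^ 2) : ℝ) : ℂ) =
      Complex.I * ((α ^ 2 * (sin φ * cos φ) * √(c ^ 2 - α ^ 2 * sin φ ^ 2) : ℝ) : ℂ) := by
  obtain ⟨hs, hc⟩ := sin_cos_pos_of_mem hφ
  have hcpos : 0 < c := hα.trans hαc
  have hD := radicand_pos (C := c ^ 2) (q := α ^ 2) (by positivity) (by gcongr) φ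
  have e1 : -((-(α ^ 2 * sin φ ^ 2) : ℝ) : ℂ) = (((α * sin φ) ^ 2 : ℝ) : ℂ) := by push_cast; ring
  have e2 : ((-(α ^ 2 * sin φ ^ 2) : ℝ) : ℂ) + (c : ℂ) ^ 2 =
      ((c ^ 2 - α ^ 2 * sin φ ^ 2 : ℝ) : ℂ) := by push_cast; ring
  have e3 : ((-(α ^ 2 * sin φ ^ 2) : ℝ) : ℂ) + (α : ℂ) ^ 2 = (((α * cos φ) ^ 2 : ℝ) : ℂ) := by
    rw [mul_pow, cos_sq']; push_cast; ring
  rw [R, e1, e2, e3, cpow_half_ofReal (sq_nonneg _), cpow_half_ofReal hD.le,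
    cpow_half_ofReal (sq_nonneg _), sqrt_sq (by positivity), sqrt_sq (by positivity)]
  push_cast
  ring

/-- The `𝔞`-period of a quadratic differential `(e₀ + e₁ λ + e₂ λ²) dλ / R`. -/
theorem aPeriod_quadratic {c α : ℝ} (hα : 0 < α) (hαc : α < c) (e₀ e₁ e₂ : ℂ) :
    aPeriod c α (fun l y => (e₀ + e₁ * l + e₂ * l ^ 2) / y) =
      4 * Complex.I * ((e₀ - c ^ 2 * e₁ + c ^ 4 * e₂) * ellK (c ^ 2) (α ^ 2) +
        (e₁ - 2 * c ^ 2 * e₂) * ellE (c ^ 2) (α ^ 2) + e₂ * ellM (c ^ 2) (α ^ 2)) := by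
  have hcpos : 0 < c := hα.trans hαc
  have hC : 0 < c ^ 2 := by positivity
  have hq : α ^ 2 < c ^ 2 := by gcongr
  have hder : ∀ φ : ℝ, HasDerivAt (fun φ => -(α ^ 2 * sin φ ^ 2)) (-(2 * α ^ 2 * (sin φ * cos φ)))
      φ := fun φ => by
    refine ((((hasDerivAt_sin φ).fun_pow 2).const_mul (α ^ 2)).fun_neg).congr_deriv ?_
    push_cast; ring
  -- The substitution λ = -α² sin² φ cancels the inverse-root singularities at both branch points,
  -- and λ = D² - c² makes the integrand a polynomial in D² over D.
  have hsub := integral_deriv_smul_comp_of_deriv_nonpos (a := 0) (b := π / 2)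
    (f := fun φ => -(α ^ 2 * sin φ ^ 2)) (f' := fun φ => -(2 * α ^ 2 * (sin φ * cos φ)))
    (g := fun l : ℝ => (e₀ + e₁ * l + e₂ * (l : ℂ) ^ 2) / R c α l) (by fun_prop)
    (fun φ _ => hder φ) (fun φ hφ => by
      obtain ⟨hs, hc⟩ := sin_cos_pos_of_mem (mem_Ioo_of_min_max hφ)
      simp only [Left.neg_nonpos_iff]; positivity)
  simp only [sin_zero, sin_pi_div_two, one_pow, mul_one, ne_eq, OfNat.ofNat_ne_zero,
    not_false_eq_true, zero_pow, mul_zero, neg_zero] at hsub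
  have hval : ∫ l in (0 : ℝ)..(-α ^ 2), (e₀ + e₁ * (l : ℂ) + e₂ * (l : ℂ) ^ 2) / R c α l =
      2 * Complex.I * ((e₀ - c ^ 2 * e₁ + c ^ 4 * e₂) * ellK (c ^ 2) (α ^ 2) +
        (e₁ - 2 * c ^ 2 * e₂) * ellE (c ^ 2) (α ^ 2) + e₂ * ellM (c ^ 2) (α ^ 2)) := by
    rw [← hsub, ← integral_quadratic hC hq, ← intervalIntegral.integral_const_mul]
    refine integral_congr_Ioo_of_le (by positivity) fun φ hφ => ?_
    obtain ⟨hs, hc⟩ := sin_cos_pos_of_mem hφ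
    have hD : (√(c ^ 2 - α ^ 2 * sin φ ^ 2) : ℂ) ≠ 0 :=
      Complex.ofReal_ne_zero.2 (sqrt_radicand_ne_zero hC hq φ)
    have hD2 : ((-(α ^ 2 * sin φ ^ 2) : ℝ) : ℂ) =
        (√(c ^ 2 - α ^ 2 * sin φ ^ 2) : ℂ) ^ 2 - (c : ℂ) ^ 2 := by
      rw [← Complex.ofReal_pow, sq_sqrt (radicand_pos hC hq φ).le]; push_cast; ring
    have h1 : (sin φ : ℂ) ≠ 0 := Complex.ofReal_ne_zero.2 hs.ne'
    have h2 : (cos φ : ℂ) ≠ 0 := Complex.ofReal_ne_zero.2 hc.ne'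
    have h3 : (α : ℂ) ≠ 0 := Complex.ofReal_ne_zero.2 hα.ne'
    simp only [Function.comp_apply, R_on_gap hα hαc hφ]
    rw [Complex.real_smul, hD2]
    simp only [Complex.ofReal_mul, Complex.ofReal_neg, Complex.ofReal_pow, Complex.ofReal_ofNat]
    generalize (√(c ^ 2 - α ^ 2 * sin φ ^ 2) : ℂ) = D at *
    have hI := Complex.I_ne_zero
    field_simp
    rw [Complex.I_sq]
    ring
  -- The change of sheet and the reversed direction each contribute a sign, so the two halves of the
  -- cycle agree.
  rw [aPeriod]
  simp only [div_neg, intervalIntegral.integral_neg]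
  rw [← intervalIntegral.integral_symm, hval]
  ring

theorem integral_cos_half {F : ℝ → ℂ} (hF : Continuous fun φ => F (sin φ ^ 2)) :
    ∫ θ in (0 : ℝ)..2 * π, F (cos (θ / 2) ^ 2) = 4 * ∫ φ in (0 : ℝ)..π / 2, F (sin φ ^ 2) := by
  have hG : Continuous fun φ => F (cos φ ^ 2) := by
    have h : Continuous fun φ : ℝ => φ + π / 2 := by fun_prop
    simpa only [Function.comp_def, sin_add_pi_div_two] using hF.comp h
  have h1 : ∫ θ in (0 : ℝ)..2 * π, F (cos (θ / 2) ^ 2) =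
      (2 : ℝ) • ∫ φ in (0 : ℝ)..π, F (cos φ ^ 2) := by
    have h := intervalIntegral.integral_comp_div (a := 0) (b := 2 * π)
      (fun φ => F (cos φ ^ 2)) (two_ne_zero' ℝ)
    rwa [zero_div, mul_div_cancel_left₀ _ (two_ne_zero' ℝ)] at h
  have h2 : ∫ φ in (π / 2)..π, F (cos φ ^ 2) = ∫ φ in (0 : ℝ)..π / 2, F (cos φ ^ 2) := by
    have h := intervalIntegral.integral_comp_sub_left (a := 0) (b := π / 2)
      (fun φ => F (cos φ ^ 2)) π
    simp only [cos_pi_sub, neg_sq, sub_zero] at h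
    rw [h]; congr 1; ring
  have h3 : ∫ φ in (0 : ℝ)..π / 2, F (cos φ ^ 2) = ∫ φ in (0 : ℝ)..π / 2, F (sin φ ^ 2) := by
    have h := intervalIntegral.integral_comp_sub_left (a := 0) (b := π / 2)
      (fun φ => F (sin φ ^ 2)) (π / 2)
    simpa only [sin_pi_div_two_sub, sub_self, sub_zero] using h
  rw [h1, ← integral_add_adjacent_intervals (hG.intervalIntegrable 0 (π / 2))
    (hG.intervalIntegrable (π / 2) π), h2, h3, Complex.real_smul]
  push_cast
  ring

/-- The `𝔟`-period of a quadratic differential `(e₀ + e₁ λ + e₂ λ²) dλ / R`. -/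
theorem bPeriod_quadratic {c α : ℝ} (hα : 0 < α) (hαc : α < c) (e₀ e₁ e₂ : ℂ) :
    bPeriod c α (fun l y => (e₀ + e₁ * l + e₂ * l ^ 2) / y) =
      -4 * (e₀ * ellK (c ^ 2) (c ^ 2 - α ^ 2) - e₁ * ellE (c ^ 2) (c ^ 2 - α ^ 2) +
        e₂ * ellM (c ^ 2) (c ^ 2 - α ^ 2)) := by
  have hcpos : 0 < c := hα.trans hαc
  have hC : 0 < c ^ 2 := by positivity
  have hα2 : 0 < α ^ 2 := by positivity
  have hq : α ^ 2 < c ^ 2 := by gcongr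
  have hq' : c ^ 2 - α ^ 2 < c ^ 2 := by linarith
  -- The factor without the cut [-c², -α²]. It is analytic on the disc because c²/2 < (c² + α²)/2
  -- keeps the disc in Re λ < 0.
  set g : ℂ → ℂ := fun l => (e₀ + e₁ * l + e₂ * l ^ 2) * (Complex.I * (-l) ^ (1 / 2 : ℂ))⁻¹ with hg
  have hcenter : -((c : ℂ) ^ 2 + (α : ℂ) ^ 2) / 2 = ((-(c ^ 2 + α ^ 2) / 2 : ℝ) : ℂ) := by
    push_cast; ring
  have hdiff : DifferentiableOn ℂ g
      (Metric.closedBall ((-(c ^ 2 + α ^ 2) / 2 : ℝ) : ℂ) (c ^ 2 / 2)) := by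
    intro l hl
    have hre : l.re < 0 := by
      rw [Metric.mem_closedBall, Complex.dist_eq] at hl
      have h := (Complex.re_le_norm _).trans hl
      rw [Complex.sub_re, Complex.ofReal_re] at h
      linarith
    have hslit : -l ∈ Complex.slitPlane := Or.inl (by simpa using hre)
    have hne : -l ≠ 0 := Complex.slitPlane_ne_zero hslit
    have h1 : DifferentiableAt ℂ (fun l : ℂ => (-l) ^ (1 / 2 : ℂ)) l :=
      (differentiableAt_id.neg).cpow (differentiableAt_const _) hslit
    have h2 : Complex.I * (-l) ^ (1 / 2 : ℂ) ≠ 0 :=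
      mul_ne_zero Complex.I_ne_zero (by rw [Ne, Complex.cpow_eq_zero_iff]; tauto)
    exact (DifferentiableAt.fun_mul (by fun_prop)
      ((h1.const_mul Complex.I).fun_inv h2)).differentiableWithinAt
  have hcol := circleIntegral_collapse hq (ρ := c ^ 2 / 2) (by linarith) hdiff
  have hint : ∀ l : ℂ, (e₀ + e₁ * l + e₂ * l ^ 2) / R c α l =
      g l * ((l + (c ^ 2 : ℝ)) ^ (1 / 2 : ℂ) * (l + (α ^ 2 : ℝ)) ^ (1 / 2 : ℂ))⁻¹ := by
    intro l
    rw [hg, R, div_eq_mul_inv, mul_assoc (Complex.I * _), mul_inv, ← mul_assoc]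
    push_cast
    rfl
  rw [bPeriod, hcenter]
  simp only [hint]
  rw [hcol]
  -- On the cut -λ = c² - (c² - α²) cos²(θ/2), which is where the complementary parameter enters.
  set F : ℝ → ℂ := fun x => (e₀ + -e₁ * (√(c ^ 2 - (c ^ 2 - α ^ 2) * x) : ℂ) ^ 2 +
      e₂ * (√(c ^ 2 - (c ^ 2 - α ^ 2) * x) : ℂ) ^ 4) / (√(c ^ 2 - (c ^ 2 - α ^ 2) * x) : ℂ) with hF
  have hFc : Continuous fun φ => F (sin φ ^ 2) := by
    refine Continuous.div (by fun_prop) (by fun_prop) fun φ => ?_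
    exact Complex.ofReal_ne_zero.2 (sqrt_radicand_ne_zero hC hq' φ)
  have hgF : ∀ θ : ℝ, g ((-(c ^ 2 + α ^ 2) / 2 + (c ^ 2 - α ^ 2) / 2 * Real.cos θ : ℝ) : ℂ) =
      -Complex.I * F (cos (θ / 2) ^ 2) := by
    intro θ
    have hcos : cos θ = 2 * cos (θ / 2) ^ 2 - 1 := by
      rw [← cos_two_mul]; congr 1; ring
    have hpos : 0 < c ^ 2 - (c ^ 2 - α ^ 2) * cos (θ / 2) ^ 2 := by
      have := radicand_pos hC hq' (θ / 2 + π / 2)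
      rwa [sin_add_pi_div_two] at this
    have hx : (-(c ^ 2 + α ^ 2) / 2 + (c ^ 2 - α ^ 2) / 2 * Real.cos θ : ℝ) =
        -(c ^ 2 - (c ^ 2 - α ^ 2) * cos (θ / 2) ^ 2) := by rw [hcos]; ring
    have hD2 : ((c ^ 2 - (c ^ 2 - α ^ 2) * cos (θ / 2) ^ 2 : ℝ) : ℂ) =
        (√(c ^ 2 - (c ^ 2 - α ^ 2) * cos (θ / 2) ^ 2) : ℂ) ^ 2 := by
      rw [← Complex.ofReal_pow, sq_sqrt hpos.le]
    have hD : (√(c ^ 2 - (c ^ 2 - α ^ 2) * cos (θ / 2) ^ 2) : ℂ) ≠ 0 :=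
      Complex.ofReal_ne_zero.2 (sqrt_pos.2 hpos).ne'
    rw [hx]
    simp only [hg, hF]
    rw [Complex.ofReal_neg, neg_neg, cpow_half_ofReal hpos.le, hD2]
    generalize (√(c ^ 2 - (c ^ 2 - α ^ 2) * cos (θ / 2) ^ 2) : ℂ) = D at *
    rw [mul_inv, Complex.inv_I]
    field_simp
  simp only [hgF]
  rw [intervalIntegral.integral_const_mul, integral_cos_half hFc, hF]
  simp only
  rw [integral_quadratic hC hq']
  linear_combination (4 * (e₀ * ellK (c ^ 2) (c ^ 2 - α ^ 2) - e₁ * ellE (c ^ 2) (c ^ 2 - α ^ 2) +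
        e₂ * ellM (c ^ 2) (c ^ 2 - α ^ 2))) * Complex.I_sq

theorem integral_inv_sqrt_gap {c α : ℝ} (hα : 0 < α) (hαc : α < c) :
    ∫ s in (-α)..α, (√((c ^ 2 - s ^ 2) * (α ^ 2 - s ^ 2)))⁻¹ = 2 * ellK (c ^ 2) (α ^ 2) := by
  have hcpos : 0 < c := hα.trans hαc
  have hC : 0 < c ^ 2 := by positivity
  have hq : α ^ 2 < c ^ 2 := by gcongr
  have hπ : -(π / 2) ≤ π / 2 := by linarith [pi_pos]
  have hsub := integral_comp_mul_deriv_of_deriv_nonneg (a := -(π / 2)) (b := π / 2)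
    (f := fun φ => α * sin φ) (f' := fun φ => α * cos φ)
    (g := fun s : ℝ => (√((c ^ 2 - s ^ 2) * (α ^ 2 - s ^ 2)))⁻¹) (by fun_prop)
    (fun φ _ => (hasDerivAt_sin φ).const_mul α) (fun φ hφ => by
      rw [min_eq_left hπ, max_eq_right hπ] at hφ
      have := cos_pos_of_mem_Ioo hφ
      positivity)
  simp only [sin_neg, sin_pi_div_two, mul_one, mul_neg] at hsub
  have hcont := continuous_ellK_integrand hC hq
  have hhalf : ∫ φ in (-(π / 2))..0, (√(c ^ 2 - α ^ 2 * sin φ ^ 2))⁻¹ = ellK (c ^ 2) (α ^ 2) := by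
    have h := intervalIntegral.integral_comp_neg (a := 0) (b := π / 2)
      (fun φ => (√(c ^ 2 - α ^ 2 * sin φ ^ 2))⁻¹)
    simp only [sin_neg, neg_sq, neg_zero] at h
    exact h.symm
  have hfull : ∫ φ in (-(π / 2))..(π / 2), (√(c ^ 2 - α ^ 2 * sin φ ^ 2))⁻¹ =
      2 * ellK (c ^ 2) (α ^ 2) := by
    rw [← integral_add_adjacent_intervals (hcont.intervalIntegrable _ 0)
      (hcont.intervalIntegrable 0 _), hhalf, two_mul]
    rfl
  rw [← hsub, ← hfull]
  refine integral_congr_Ioo_of_le hπ fun φ hφ => ?_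
  have hc := cos_pos_of_mem_Ioo hφ
  have hD := sqrt_radicand_ne_zero hC hq φ
  simp only [Function.comp_apply]
  rw [show (c ^ 2 - (α * sin φ) ^ 2) * (α ^ 2 - (α * sin φ) ^ 2) =
    (c ^ 2 - α ^ 2 * sin φ ^ 2) * (α * cos φ) ^ 2 by rw [mul_pow α (cos φ), cos_sq']; ring,
    sqrt_mul (radicand_pos hC hq φ).le, sqrt_sq (by positivity)]
  field_simp

/-- Substitute s = α sin φ and eliminate `ellM`. -/
theorem integral_bandEdge {c α : ℝ} (hα : 0 < α) (hαc : α < c) (ξ : ℝ) :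
    ∫ s in (0 : ℝ)..α, (ξ + (c ^ 2 - α ^ 2) / 2 - s ^ 2) * √((α ^ 2 - s ^ 2) / (c ^ 2 - s ^ 2)) =
      bandFun (c ^ 2) ξ (α ^ 2) := by
  have hcpos : 0 < c := hα.trans hαc
  have hC : 0 < c ^ 2 := by positivity
  have hq : α ^ 2 < c ^ 2 := by gcongr
  have hsub := integral_comp_mul_deriv_of_deriv_nonneg (a := 0) (b := π / 2)
    (f := fun φ => α * sin φ) (f' := fun φ => α * cos φ)
    (g := fun s : ℝ => (ξ + (c ^ 2 - α ^ 2) / 2 - s ^ 2) * √((α ^ 2 - s ^ 2) / (c ^ 2 - s ^ 2)))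
    (by fun_prop) (fun φ _ => (hasDerivAt_sin φ).const_mul α) (fun φ hφ => by
      have := (sin_cos_pos_of_mem (mem_Ioo_of_min_max hφ)).2
      positivity)
  simp only [sin_zero, sin_pi_div_two, mul_one, mul_zero] at hsub
  -- The coefficients come from expanding (ξ - (c² + α²)/2 + D²)(α² - c² + D²), where α² sin² φ = c²
  -- - D².
  have hquad := integral_quadratic_real hC hq (-((c ^ 2 - α ^ 2) * (ξ - (c ^ 2 + α ^ 2) / 2)))
    (ξ - 3 * c ^ 2 / 2 + α ^ 2 / 2) 1
  have hfin : bandFun (c ^ 2) ξ (α ^ 2) = -((c ^ 2 - α ^ 2) * (ξ - (c ^ 2 + α ^ 2) / 2)) *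
      ellK (c ^ 2) (α ^ 2) + (ξ - 3 * c ^ 2 / 2 + α ^ 2 / 2) * ellE (c ^ 2) (α ^ 2) +
      1 * ellM (c ^ 2) (α ^ 2) := by
    rw [bandFun, bandSlope, bandConst]
    linear_combination -(1 / 3) * three_mul_ellM hC hq
  rw [← hsub, hfin, ← hquad]
  refine integral_congr_Ioo_of_le (by positivity) fun φ hφ => ?_
  obtain ⟨hs, hc⟩ := sin_cos_pos_of_mem hφ
  have hD := sqrt_radicand_ne_zero hC hq φ
  have hD2 := sq_sqrt (radicand_pos hC hq φ).le
  simp only [Function.comp_apply]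
  rw [show α ^ 2 - (α * sin φ) ^ 2 = (α * cos φ) ^ 2 by rw [mul_pow α (cos φ), cos_sq']; ring,
    mul_pow α (sin φ), sqrt_div (sq_nonneg _), sqrt_sq (by positivity)]
  have hsin : α ^ 2 * sin φ ^ 2 = c ^ 2 - √(c ^ 2 - α ^ 2 * sin φ ^ 2) ^ 2 := by linarith
  have hcos : α ^ 2 * cos φ ^ 2 = α ^ 2 - c ^ 2 + √(c ^ 2 - α ^ 2 * sin φ ^ 2) ^ 2 := by
    rw [cos_sq']; linarith
  have hsplit : (ξ + (c ^ 2 - α ^ 2) / 2 - α ^ 2 * sin φ ^ 2) *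
      (α * cos φ / √(c ^ 2 - α ^ 2 * sin φ ^ 2)) * (α * cos φ) =
      (ξ + (c ^ 2 - α ^ 2) / 2 - α ^ 2 * sin φ ^ 2) * (α ^ 2 * cos φ ^ 2) /
        √(c ^ 2 - α ^ 2 * sin φ ^ 2) := by ring
  rw [hsplit, hcos]
  congr 1
  generalize √(c ^ 2 - α ^ 2 * sin φ ^ 2) = D at *
  rw [hsin]
  ring

/-- The radicand is nonpositive on [0, α], so the principal root is i times a real root and the
complex equation is -i times a real one. -/
theorem isBandEdge_iff {c ξ α : ℝ} :
    IsBandEdge c ξ α ↔ 0 < α ∧ α < c ∧ bandFun (c ^ 2) ξ (α ^ 2) = 0 := by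
  refine and_congr_right fun hα => and_congr_right fun hαc => ?_
  have h : ∫ s in α..0, ((ξ + (c ^ 2 - α ^ 2) / 2 - s ^ 2 : ℝ) : ℂ) *
      (((s ^ 2 - α ^ 2) / (c ^ 2 - s ^ 2) : ℝ) : ℂ) ^ (1 / 2 : ℂ) =
      -(Complex.I * (bandFun (c ^ 2) ξ (α ^ 2) : ℂ)) := by
    rw [intervalIntegral.integral_symm, ← integral_bandEdge hα hαc,
      ← intervalIntegral.integral_ofReal, ← intervalIntegral.integral_const_mul]
    congr 1
    refine intervalIntegral.integral_congr fun s hs => ?_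
    rw [uIcc_of_le hα.le] at hs
    have h1 : s ^ 2 ≤ α ^ 2 := pow_le_pow_left₀ hs.1 hs.2 2
    have h2 : α ^ 2 < c ^ 2 := by gcongr
    rw [cpow_half_ofReal_of_nonpos (div_nonpos_of_nonpos_of_nonneg (by linarith) (by linarith)),
      ← neg_div, neg_sub, Complex.ofReal_mul]
    ring
  rw [h]
  simp

/-- The substitution s² = c² - (c² - a²) sin² φ runs from c down to a and turns the root into cot φ.
-/
theorem B_eq {c ξ : ℝ} (hα : 0 < a c ξ) (hαc : a c ξ < c) :
    B c ξ = 24 * ((ξ - (c ^ 2 + a c ξ ^ 2) / 6) * ellE (c ^ 2) (c ^ 2 - a c ξ ^ 2) -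
      a c ξ ^ 2 * (ξ + c ^ 2 / 6 - a c ξ ^ 2 / 2) * ellK (c ^ 2) (c ^ 2 - a c ξ ^ 2)) := by
  rw [B]
  generalize a c ξ = α at *
  have hcpos : 0 < c := hα.trans hαc
  have hC : 0 < c ^ 2 := by positivity
  have hα2 : 0 < α ^ 2 := by positivity
  have hq : α ^ 2 < c ^ 2 := by gcongr
  have hq' : c ^ 2 - α ^ 2 < c ^ 2 := by linarith
  have hsub := integral_comp_mul_deriv_of_deriv_nonpos (a := 0) (b := π / 2)
    (f := fun φ => √(c ^ 2 - (c ^ 2 - α ^ 2) * sin φ ^ 2))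
    (f' := fun φ => -((c ^ 2 - α ^ 2) * sin φ * cos φ) / √(c ^ 2 - (c ^ 2 - α ^ 2) * sin φ ^ 2))
    (g := fun s : ℝ => (ξ + (c ^ 2 - α ^ 2) / 2 - s ^ 2) * √((s ^ 2 - α ^ 2) / (c ^ 2 - s ^ 2)))
    (by fun_prop) (fun φ _ => hasDerivAt_sqrt_radicand hC hq' φ) (fun φ hφ => by
      obtain ⟨hs, hc⟩ := sin_cos_pos_of_mem (mem_Ioo_of_min_max hφ)
      have := sub_pos.2 hq
      rw [neg_div, Left.neg_nonpos_iff]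
      positivity)
  simp only [sin_zero, sin_pi_div_two, one_pow, mul_one, ne_eq, OfNat.ofNat_ne_zero,
    not_false_eq_true, zero_pow, mul_zero, sub_zero, sub_sub_cancel, sqrt_sq hcpos.le,
    sqrt_sq hα.le] at hsub
  have hquad := integral_quadratic_real hC hq' (-(α ^ 2 * (ξ + (c ^ 2 - α ^ 2) / 2)))
    (ξ + (c ^ 2 + α ^ 2) / 2) (-1)
  rw [intervalIntegral.integral_symm, ← hsub]
  have hfin : (ξ - (c ^ 2 + α ^ 2) / 6) * ellE (c ^ 2) (c ^ 2 - α ^ 2) -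
      α ^ 2 * (ξ + c ^ 2 / 6 - α ^ 2 / 2) * ellK (c ^ 2) (c ^ 2 - α ^ 2) =
      -(α ^ 2 * (ξ + (c ^ 2 - α ^ 2) / 2)) * ellK (c ^ 2) (c ^ 2 - α ^ 2) +
      (ξ + (c ^ 2 + α ^ 2) / 2) * ellE (c ^ 2) (c ^ 2 - α ^ 2) +
      -1 * ellM (c ^ 2) (c ^ 2 - α ^ 2) := by
    linear_combination (1 / 3) * three_mul_ellM hC hq'
  rw [hfin, ← hquad, ← intervalIntegral.integral_neg]
  congr 1
  refine integral_congr_Ioo_of_le (by positivity) fun φ hφ => ?_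
  obtain ⟨hs, hc⟩ := sin_cos_pos_of_mem hφ
  have hD := sqrt_radicand_ne_zero hC hq' φ
  have hD2 := sq_sqrt (radicand_pos hC hq' φ).le
  have hr := sub_pos.2 hq
  simp only [Function.comp_apply]
  have hrat : √((√(c ^ 2 - (c ^ 2 - α ^ 2) * sin φ ^ 2) ^ 2 - α ^ 2) /
      (c ^ 2 - √(c ^ 2 - (c ^ 2 - α ^ 2) * sin φ ^ 2) ^ 2)) = cos φ / sin φ := by
    rw [hD2, show (c ^ 2 - (c ^ 2 - α ^ 2) * sin φ ^ 2 - α ^ 2) /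
      (c ^ 2 - (c ^ 2 - (c ^ 2 - α ^ 2) * sin φ ^ 2)) = (cos φ / sin φ) ^ 2 by
        rw [div_pow, cos_sq']
        have := hr.ne'
        field_simp
        ring, sqrt_sq (by positivity)]
  have hcos : (c ^ 2 - α ^ 2) * cos φ ^ 2 = √(c ^ 2 - (c ^ 2 - α ^ 2) * sin φ ^ 2) ^ 2 - α ^ 2 := by
    rw [cos_sq', hD2]; ring
  rw [hrat]
  generalize √(c ^ 2 - (c ^ 2 - α ^ 2) * sin φ ^ 2) = D at *
  have hs' := hs.ne'
  field_simp
  linear_combination (ξ * 2 + (c ^ 2 - α ^ 2) - 2 * D ^ 2) * hcos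

theorem existsUnique_isBandEdge {c ξ : ℝ} (hc : 0 < c) (hξ : ξ ∈ Ioo (-c ^ 2 / 2) (c ^ 2 / 3)) :
    ∃! α : ℝ, IsBandEdge c ξ α := by
  obtain ⟨q, hq, hq0, -, hl, hr⟩ := exists_bandFun_zero (sq_pos_of_pos hc) hξ
  refine ⟨√q, isBandEdge_iff.2 ⟨sqrt_pos.2 hq.1, (sqrt_lt' hc).2 hq.2, by rwa [sq_sqrt hq.1.le]⟩,
    fun α hα => ?_⟩
  obtain ⟨h0, hαc, hz⟩ := isBandEdge_iff.1 hα
  have hαq : α ^ 2 = q := by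
    rcases lt_trichotomy (α ^ 2) q with h | h | h
    · exact absurd hz (hl _ ⟨by positivity, h⟩).ne'
    · exact h
    · exact absurd hz (hr _ ⟨h, by gcongr⟩).ne
  rw [← hαq, sqrt_sq h0.le]

theorem isBandEdge_a {c ξ : ℝ} (hc : 0 < c) (hξ : ξ ∈ Ioo (-c ^ 2 / 2) (c ^ 2 / 3)) :
    IsBandEdge c ξ (a c ξ) :=
  Classical.epsilon_spec (existsUnique_isBandEdge hc hξ).exists

/-! ### Closed forms for the periods of dΩ₁ and dΩ₃, and the zeros of dΩ₃. -/

section Periods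

variable {c α : ℝ}

theorem hOf_eq (hα : 0 < α) (hαc : α < c) :
    hOf c α = ((ellE (c ^ 2) (α ^ 2) / ellK (c ^ 2) (α ^ 2) - c ^ 2 : ℝ) : ℂ) := by
  have hcpos : 0 < c := hα.trans hαc
  have hK : (ellK (c ^ 2) (α ^ 2) : ℂ) ≠ 0 :=
    Complex.ofReal_ne_zero.2 (ellK_pos (by positivity) (by gcongr)).ne'
  have h1 := aPeriod_quadratic hα hαc 0 1 0
  have h2 := aPeriod_quadratic hα hαc 1 0 0
  simp only [zero_add, one_mul, zero_mul, add_zero, mul_zero, sub_zero, mul_one, zero_sub] at h1 h2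
  rw [hOf, h1, h2]
  have hI := Complex.I_ne_zero
  push_cast
  field_simp
  ring

theorem bPeriod_dOmega1 (hα : 0 < α) (hαc : α < c) :
    bPeriod c α (dOmega1 c α) / Complex.I =
      2 * (ellE (c ^ 2) (c ^ 2 - α ^ 2) + hOf c α * ellK (c ^ 2) (c ^ 2 - α ^ 2)) := by
  have h : dOmega1 c α = fun l y => (-(Complex.I / 2 * hOf c α) + Complex.I / 2 * l +
      0 * l ^ 2) / y := by
    funext l y
    rw [dOmega1]; ring
  rw [h, bPeriod_quadratic hα hαc, div_eq_iff Complex.I_ne_zero]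
  ring

theorem dOmega3Form_eq (ν : ℝ × ℝ) : dOmega3Form ν = fun l y =>
    (-(3 * Complex.I / 2) * (ν.1 * ν.2 : ℝ) + 3 * Complex.I / 2 * (ν.1 + ν.2 : ℝ) * l +
      -(3 * Complex.I / 2) * l ^ 2) / y := by
  funext l y
  rw [dOmega3Form]
  push_cast
  ring

theorem aPeriod_dOmega3Form (hα : 0 < α) (hαc : α < c) (ν : ℝ × ℝ) :
    aPeriod c α (dOmega3Form ν) =
      ((6 * ((ν.1 * ν.2 + c ^ 2 * (ν.1 + ν.2) + c ^ 4) * ellK (c ^ 2) (α ^ 2) -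
        (ν.1 + ν.2 + 2 * c ^ 2) * ellE (c ^ 2) (α ^ 2) + ellM (c ^ 2) (α ^ 2)) : ℝ) : ℂ) := by
  rw [dOmega3Form_eq, aPeriod_quadratic hα hαc]
  push_cast
  linear_combination (-6 * ((ν.1 * ν.2 + c ^ 2 * (ν.1 + ν.2) + c ^ 4) * ellK (c ^ 2) (α ^ 2) -
    (ν.1 + ν.2 + 2 * c ^ 2) * ellE (c ^ 2) (α ^ 2) + ellM (c ^ 2) (α ^ 2))) * Complex.I_sq

theorem bPeriod_dOmega3Form (hα : 0 < α) (hαc : α < c) (ν : ℝ × ℝ) :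
    bPeriod c α (dOmega3Form ν) / Complex.I =
      ((6 * (ν.1 * ν.2 * ellK (c ^ 2) (c ^ 2 - α ^ 2) +
        (ν.1 + ν.2) * ellE (c ^ 2) (c ^ 2 - α ^ 2) + ellM (c ^ 2) (c ^ 2 - α ^ 2)) : ℝ) : ℂ) := by
  rw [dOmega3Form_eq, bPeriod_quadratic hα hαc, div_eq_iff Complex.I_ne_zero]
  push_cast
  ring

/-- The periods see the zeros only through their sum and product, and both are determined; the
choice made in `nu` is therefore immaterial. -/
theorem isZeroPair_iff (hα : 0 < α) (hαc : α < c) (ν : ℝ × ℝ) :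
    IsZeroPair c α ν ↔ ν.1 + ν.2 = -(c ^ 2 + α ^ 2) / 2 ∧ ν.1 * ν.2 = c ^ 2 * α ^ 2 / 3 +
      (c ^ 2 + α ^ 2) / 6 * (ellE (c ^ 2) (α ^ 2) / ellK (c ^ 2) (α ^ 2) - c ^ 2) := by
  have hcpos : 0 < c := hα.trans hαc
  have hC : 0 < c ^ 2 := by positivity
  have hq : α ^ 2 < c ^ 2 := by gcongr
  have hK := (ellK_pos hC hq).ne'
  have hM := three_mul_ellM hC hq
  rw [IsZeroPair, aPeriod_dOmega3Form hα hαc, Complex.ofReal_eq_zero]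
  constructor
  · rintro ⟨h1, h2⟩
    have hσ : ν.1 + ν.2 = -(c ^ 2 + α ^ 2) / 2 := by linarith
    refine ⟨hσ, ?_⟩
    rw [hσ] at h2
    field_simp
    linear_combination 3 * h2 - 6 * hM
  · rintro ⟨h1, h2⟩
    refine ⟨by linarith, ?_⟩
    rw [h1, h2]
    field_simp
    linear_combination 12 * hM

theorem exists_isZeroPair (hα : 0 < α) (hαc : α < c) : ∃ ν : ℝ × ℝ, IsZeroPair c α ν := by
  have hcpos : 0 < c := hα.trans hαc
  have hC : 0 < c ^ 2 := by positivity
  have hq : α ^ 2 < c ^ 2 := by gcongr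
  have hK := ellK_pos hC hq
  have hM := three_mul_ellM hC hq
  set σ : ℝ := -(c ^ 2 + α ^ 2) / 2 with hσ
  set p : ℝ := c ^ 2 * α ^ 2 / 3 +
      (c ^ 2 + α ^ 2) / 6 * (ellE (c ^ 2) (α ^ 2) / ellK (c ^ 2) (α ^ 2) - c ^ 2) with hp
  -- The integrand is (λ - σ/2)²/D with λ = D² - c². Vanishing of the 𝔞-period would make its
  -- integral (σ²/4 - p)K, so the discriminant is nonnegative and the zeros can be chosen real.
  have hnonneg : 0 ≤ ∫ φ in (0 : ℝ)..π / 2, ((c ^ 2 + σ / 2) ^ 2 +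
      -(2 * c ^ 2 + σ) * √(c ^ 2 - α ^ 2 * sin φ ^ 2) ^ 2 +
      1 * √(c ^ 2 - α ^ 2 * sin φ ^ 2) ^ 4) / √(c ^ 2 - α ^ 2 * sin φ ^ 2) := by
    refine intervalIntegral.integral_nonneg (by positivity) fun φ _ => ?_
    refine div_nonneg ?_ (sqrt_nonneg _)
    nlinarith [sq_nonneg (√(c ^ 2 - α ^ 2 * sin φ ^ 2) ^ 2 - (c ^ 2 + σ / 2))]
  rw [integral_quadratic_real hC hq] at hnonneg
  have hdisc : 0 ≤ σ ^ 2 / 4 - p := by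
    refine le_of_mul_le_mul_right ?_ hK
    have h1 : (σ ^ 2 / 4 - p) * ellK (c ^ 2) (α ^ 2) = (c ^ 2 + σ / 2) ^ 2 * ellK (c ^ 2) (α ^ 2) +
        -(2 * c ^ 2 + σ) * ellE (c ^ 2) (α ^ 2) + 1 * ellM (c ^ 2) (α ^ 2) := by
      have hK' := hK.ne'
      rw [hp, hσ]
      field_simp
      linear_combination -384 * hM
    rw [h1, zero_mul]
    exact hnonneg
  refine ⟨(σ / 2 + √(σ ^ 2 / 4 - p), σ / 2 - √(σ ^ 2 / 4 - p)),
    (isZeroPair_iff hα hαc _).2 ⟨?_, ?_⟩⟩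
  · simp only; ring
  · simp only
    linear_combination -(sq_sqrt hdisc)

end Periods

/-! ### The identities between B, V, W, Γ, h and z. -/

section Identities

variable {c ξ : ℝ}

/-- The real value of `h(ξ)`. -/
def hReal (c ξ : ℝ) : ℝ := ellE (c ^ 2) (a c ξ ^ 2) / ellK (c ^ 2) (a c ξ ^ 2) - c ^ 2

/-- The real value of `V(ξ)`. -/
def VReal (c ξ : ℝ) : ℝ := 2 * (ellE (c ^ 2) (c ^ 2 - a c ξ ^ 2) +
  hReal c ξ * ellK (c ^ 2) (c ^ 2 - a c ξ ^ 2))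

theorem a_pos (hc : 0 < c) (hξ : ξ ∈ Ioo (-c ^ 2 / 2) (c ^ 2 / 3)) : 0 < a c ξ :=
  (isBandEdge_a hc hξ).1

theorem a_lt (hc : 0 < c) (hξ : ξ ∈ Ioo (-c ^ 2 / 2) (c ^ 2 / 3)) : a c ξ < c :=
  (isBandEdge_a hc hξ).2.1

theorem a_sq_mem (hc : 0 < c) (hξ : ξ ∈ Ioo (-c ^ 2 / 2) (c ^ 2 / 3)) :
    a c ξ ^ 2 ∈ Ioo 0 (c ^ 2) := by
  have h1 := a_pos hc hξ
  have h2 := a_lt hc hξ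
  exact ⟨by positivity, by gcongr⟩

theorem ellE_eq_hReal (hc : 0 < c) (hξ : ξ ∈ Ioo (-c ^ 2 / 2) (c ^ 2 / 3)) :
    ellE (c ^ 2) (a c ξ ^ 2) = (hReal c ξ + c ^ 2) * ellK (c ^ 2) (a c ξ ^ 2) := by
  have hK := ellK_pos (sq_pos_of_pos hc) (a_sq_mem hc hξ).2
  rw [hReal, sub_add_cancel, div_mul_cancel₀ _ hK.ne']

/-- This is the band-edge equation divided by K. -/
theorem hReal_relation (hc : 0 < c) (hξ : ξ ∈ Ioo (-c ^ 2 / 2) (c ^ 2 / 3)) :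
    hReal c ξ * (ξ - (c ^ 2 + a c ξ ^ 2) / 6) +
      a c ξ ^ 2 * (ξ + c ^ 2 / 6 - a c ξ ^ 2 / 2) = 0 := by
  have hK := ellK_pos (sq_pos_of_pos hc) (a_sq_mem hc hξ).2
  have hband := (isBandEdge_iff.1 (isBandEdge_a hc hξ)).2.2
  rw [bandFun, bandSlope, bandConst, ellE_eq_hReal hc hξ] at hband
  refine (mul_eq_zero.1 ?_).resolve_right hK.ne'
  linear_combination hband

theorem h_eq (hc : 0 < c) (hξ : ξ ∈ Ioo (-c ^ 2 / 2) (c ^ 2 / 3)) : h c ξ = (hReal c ξ : ℂ) :=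
  hOf_eq (a_pos hc hξ) (a_lt hc hξ)

theorem V_eq (hc : 0 < c) (hξ : ξ ∈ Ioo (-c ^ 2 / 2) (c ^ 2 / 3)) : V c ξ = (VReal c ξ : ℂ) := by
  have h1 := bPeriod_dOmega1 (a_pos hc hξ) (a_lt hc hξ)
  have h2 : hOf c (a c ξ) = (hReal c ξ : ℂ) := h_eq hc hξ
  rw [V, h1, h2, VReal]
  push_cast
  rfl

/-- Once ν₁ν₂ is expressed through h and `ellM` is eliminated, the K' and E' terms combine to a
multiple of E' + hK'. -/
theorem W_eq (hc : 0 < c) (hξ : ξ ∈ Ioo (-c ^ 2 / 2) (c ^ 2 / 3)) :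
    W c ξ = (((c ^ 2 + a c ξ ^ 2) / 2 * VReal c ξ : ℝ) : ℂ) := by
  have hα := a_pos hc hξ
  have hαc := a_lt hc hξ
  have hν : IsZeroPair c (a c ξ) (nu c (a c ξ)) :=
    Classical.epsilon_spec (exists_isZeroPair hα hαc)
  obtain ⟨hν1, hν2⟩ := (isZeroPair_iff hα hαc _).1 hν
  have hW : W c ξ = _ := bPeriod_dOmega3Form hα hαc (nu c (a c ξ))
  have hM := three_mul_ellM (C := c ^ 2) (q := c ^ 2 - a c ξ ^ 2) (by positivity)
    (by linarith [(a_sq_mem hc hξ).1])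
  rw [hW, hν1, hν2, Complex.ofReal_inj, VReal]
  change 6 * ((c ^ 2 * a c ξ ^ 2 / 3 + (c ^ 2 + a c ξ ^ 2) / 6 * hReal c ξ) * _ + _ + _) = _
  linear_combination 2 * hM

/-- `hReal_relation` replaces the coefficient of K' by h times the coefficient of E'. -/
theorem B_eq_VReal (hc : 0 < c) (hξ : ξ ∈ Ioo (-c ^ 2 / 2) (c ^ 2 / 3)) :
    B c ξ = (12 * ξ - 2 * (c ^ 2 + a c ξ ^ 2)) * VReal c ξ := by
  rw [B_eq (a_pos hc hξ) (a_lt hc hξ), VReal]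
  linear_combination (-24 * ellK (c ^ 2) (c ^ 2 - a c ξ ^ 2)) * hReal_relation hc hξ

/-- Inserting E = (h + c²)K into Legendre's relation leaves K(E' + hK') = π/2. -/
theorem VReal_eq (hc : 0 < c) (hξ : ξ ∈ Ioo (-c ^ 2 / 2) (c ^ 2 / 3)) :
    VReal c ξ = π / ellK (c ^ 2) (a c ξ ^ 2) := by
  have hq := a_sq_mem hc hξ
  have hK := ellK_pos (sq_pos_of_pos hc) hq.2
  have hL := legendre_relation hq.1 hq.2
  rw [ellE_eq_hReal hc hξ] at hL
  rw [VReal, eq_div_iff hK.ne']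
  linear_combination 2 * hL

theorem Gam_eq (hc : 0 < c) (hξ : ξ ∈ Ioo (-c ^ 2 / 2) (c ^ 2 / 3)) :
    4 * π * Gam c ξ = -VReal c ξ := by
  have hK := (ellK_pos (sq_pos_of_pos hc) (a_sq_mem hc hξ).2).ne'
  rw [Gam, integral_inv_sqrt_gap (a_pos hc hξ) (a_lt hc hξ), VReal_eq hc hξ]
  field_simp
  ring

/-- Since `bandSlope` = (h + a²)K, the factor K drops out of the implicit derivative. The equation
is kept in product form so that w can be cancelled linearly. -/
theorem hasDerivAt_a_sq (hc : 0 < c) (hξ : ξ ∈ Ioo (-c ^ 2 / 2) (c ^ 2 / 3)) :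
    ∃ d, d * (ξ + c ^ 2 / 2 - 3 * a c ξ ^ 2 / 2) = -(2 * (hReal c ξ + a c ξ ^ 2)) ∧
      HasDerivAt (fun η => a c η ^ 2) d ξ := by
  obtain ⟨hneg, hder⟩ := hasDerivAt_bandFun_zero (g := fun η => a c η ^ 2) (sq_pos_of_pos hc) hξ
    fun η hη => ⟨a_sq_mem hc hη, (isBandEdge_iff.1 (isBandEdge_a hc hη)).2.2⟩
  refine ⟨_, ?_, hder⟩
  have hK := (ellK_pos (sq_pos_of_pos hc) (a_sq_mem hc hξ).2).ne'
  have hw : ξ + c ^ 2 / 2 - 3 * a c ξ ^ 2 / 2 ≠ 0 := hneg.ne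
  rw [bandSlope, ellE_eq_hReal hc hξ]
  generalize ξ + c ^ 2 / 2 - 3 * a c ξ ^ 2 / 2 = w at *
  field_simp
  ring

/-- The partial derivatives are 6(c² - a²) in ξ and -6w in a². -/
theorem hasDerivAt_z (hc : 0 < c) (hξ : ξ ∈ Ioo (-c ^ 2 / 2) (c ^ 2 / 3)) :
    HasDerivAt (z c) (6 * (c ^ 2 + a c ξ ^ 2 + 2 * hReal c ξ)) ξ := by
  obtain ⟨d, hd, hq⟩ := hasDerivAt_a_sq hc hξ
  have hz : z c = fun η => (12 * η * (c ^ 2 - a c η ^ 2) + 3 * c ^ 4 + 9 * (a c η ^ 2) ^ 2 -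
      6 * c ^ 2 * a c η ^ 2) / 2 := by
    funext η
    rw [z]; ring
  rw [hz]
  refine (((((((hasDerivAt_id' ξ).const_mul 12).fun_mul (hq.const_sub (c ^ 2))).add_const
    (3 * c ^ 4)).fun_add ((hq.fun_pow 2).const_mul 9)).fun_sub
    (hq.const_mul (6 * c ^ 2))).div_const 2).congr_deriv ?_
  push_cast
  linear_combination -6 * hd

/-- The partial derivatives are 24(E' - a²K') in ξ and -12wK' in a²; the chain rule gives 24(E' +
hK'). -/
theorem hasDerivAt_B (hc : 0 < c) (hξ : ξ ∈ Ioo (-c ^ 2 / 2) (c ^ 2 / 3)) :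
    HasDerivAt (B c) (12 * VReal c ξ) ξ := by
  have hC : 0 < c ^ 2 := by positivity
  obtain ⟨d, hd, hq⟩ := hasDerivAt_a_sq hc hξ
  obtain ⟨hq0, hqC⟩ := a_sq_mem hc hξ
  have hB : B c =ᶠ[𝓝 ξ] fun η => 24 * ((η - (c ^ 2 + a c η ^ 2) / 6) *
      ellE (c ^ 2) (c ^ 2 - a c η ^ 2) - a c η ^ 2 * (η + c ^ 2 / 6 - a c η ^ 2 / 2) *
      ellK (c ^ 2) (c ^ 2 - a c η ^ 2)) := by
    filter_upwards [Ioo_mem_nhds hξ.1 hξ.2] with η hη using B_eq (a_pos hc hη) (a_lt hc hη)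
  have hne : c ^ 2 - a c ξ ^ 2 ≠ 0 := (sub_pos.2 hqC).ne'
  have hE := (hasDerivAt_ellE hC (q := c ^ 2 - a c ξ ^ 2) (by linarith) hne).comp ξ
    (hq.const_sub (c ^ 2))
  have hK := (hasDerivAt_ellK hC (q := c ^ 2 - a c ξ ^ 2) (by linarith) hne).comp ξ
    (hq.const_sub (c ^ 2))
  simp only [Function.comp_def] at hE hK
  have h1 := (hasDerivAt_id' ξ).fun_sub ((hq.const_add (c ^ 2)).div_const 6)
  have h2 := ((hasDerivAt_id' ξ).add_const (c ^ 2 / 6)).fun_sub (hq.div_const 2)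
  refine HasDerivAt.congr_of_eventuallyEq ?_ hB
  refine (((h1.fun_mul hE).fun_sub ((hq.fun_mul h2).fun_mul hK)).const_mul 24).congr_deriv ?_
  rw [VReal, sub_sub_cancel]
  generalize ellE (c ^ 2) (c ^ 2 - a c ξ ^ 2) = E at *
  generalize ellK (c ^ 2) (c ^ 2 - a c ξ ^ 2) = K at *
  have hq0' := hq0.ne'
  generalize a c ξ ^ 2 = q at *
  field_simp
  linear_combination -288 * (c ^ 2 - q) * K * hd

end Identities

end OneGap
end

theorem mainTheorem2 (c : ℝ) (hc : 0 < c) (ξ : ℝ)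
    (hξ : ξ ∈ Set.Ioo (-c ^ 2 / 2) (c ^ 2 / 3)) :
    -- the implicitly defined quantities exist
    (∃! α : ℝ, OneGap.IsBandEdge c ξ α) ∧
    (∃ ν : ℝ × ℝ, OneGap.IsZeroPair c (OneGap.a c ξ) ν) ∧
    -- the identities; stated in `ℂ`, they include that `V`, `W` and `h` are real
    (∀ x t : ℝ, t ≠ 0 → ξ = x / (12 * t) →
      ((t * OneGap.B c ξ : ℝ) : ℂ) = -4 * OneGap.W c ξ * t + OneGap.V c ξ * x) ∧
    (DifferentiableAt ℝ (OneGap.B c) ξ ∧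
      ((deriv (OneGap.B c) ξ : ℝ) : ℂ) = 12 * OneGap.V c ξ) ∧
    ((4 * Real.pi * OneGap.Gam c ξ : ℝ) : ℂ) = -OneGap.V c ξ ∧
    (DifferentiableAt ℝ (OneGap.z c) ξ ∧
      ((1 / 6 * deriv (OneGap.z c) ξ : ℝ) : ℂ) =
        (c : ℂ) ^ 2 + (OneGap.a c ξ : ℂ) ^ 2 + 2 * OneGap.h c ξ) := by
  have hB := OneGap.hasDerivAt_B hc hξ
  have hz := OneGap.hasDerivAt_z hc hξ
  rw [OneGap.V_eq hc hξ, OneGap.W_eq hc hξ, OneGap.h_eq hc hξ, hB.deriv, hz.deriv]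
  refine ⟨OneGap.existsUnique_isBandEdge hc hξ,
    OneGap.exists_isZeroPair (OneGap.a_pos hc hξ) (OneGap.a_lt hc hξ), fun x t ht hx => ?_,
    ⟨hB.differentiableAt, by push_cast; ring⟩, ?_, ⟨hz.differentiableAt, by push_cast; ring⟩⟩
  · have hx' : x = 12 * t * ξ := by rw [hx]; field_simp
    rw [OneGap.B_eq_VReal hc hξ, hx']
    push_cast
    ring
  · rw [OneGap.Gam_eq hc hξ, Complex.ofReal_neg]
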